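/- Let $\Bbbk$ be a field, $G$ a finite simple graph with vertex set $V(G)$, and $\pi=\{W_1,\dots,W_r\}$ a clique partition of $G$, i.e. each $W_i$ is a clique of $G$ and $V(G)$ is the disjoint union of the $W_i$. Let $n_1,\dots,n_r$ be positive integers. Let $\Gamma=G^{\pi}[n_1,\dots,n_r]$ be the multi-clique-whiskered graph: its vertex set is $V(\Gamma)=V(G)\cup\{w_{i,k} : 1\le i\le r,\ 1\le k\le n_i\}$, and its edges are those of $G$ together with all $\{x,w_{i,k}\}$ with $1\le i\le r$, $x\in W_i$, $1\le k\le n_i$. Let $S=\Bbbk[V(\Gamma)]$ be the standard graded polynomial ring, $\mathfrak m$ its homogeneous maximal ideal, $I(\Gamma)=(uv : \{u,v\}\in E(\Gamma))$ the edge ideal, and $\mathrm{Min}(\Gamma)$ the set of inclusion-minimal vertex covers of $\Gamma$. Then for every integer $j\ge 1$ all graded components of the local cohomology module $H^j_{\mathfrak m}(S/I(\Gamma))$ are finite-dimensional over $\Bbbk$, and its Hilbert series, as a formal Laurent series in $t^{-1}$, is $$\sum_{\ell\in\mathbb Z}\dim_{\Bbbk}\bigl[H^j_{\mathfrak m}(S/I(\Gamma))\bigr]_{\ell}\,t^{\ell}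 =\sum_{i\ge 0}\ \sum_{\substack{C\in\mathrm{Min}(\Gamma)\\ |C|=|V(\Gamma)|-j}}\binom{|V(G)\setminus C|}{i}\left(\frac{t^{-1}}{1-t^{-1}}\right)^{j-i}.$$ -/

import Mathlib

open scoped BigOperators

noncomputable section

/-! ### Local cohomology through the Cech complex -/

section Cech

variable {S : Type*} [CommRing S] {N : ℕ} (x : Fin N → S) (M : Type*) [AddCommGroup M] [Module S M]

/-- The localization `M_{x_F}`, where `x_F = ∏_{i ∈ F} x_i`. -/
abbrev CechLoc (F : Finset (Fin N)) : Type _ :=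
  LocalizedModule (Submonoid.powers (∏ i ∈ F, x i)) M

theorem cechLoc_isUnit {G F : Finset (Fin N)} (h : G ⊆ F)
    (s : Submonoid.powers (∏ i ∈ G, x i)) :
    IsUnit (algebraMap S (Module.End S (CechLoc x M F)) s) := by
  obtain ⟨_, m, rfl⟩ := s
  have hF : IsUnit (algebraMap S (Module.End S (CechLoc x M F)) (∏ i ∈ F, x i)) :=
    IsLocalizedModule.map_units (S := Submonoid.powers (∏ i ∈ F, x i))
      (LocalizedModule.mkLinearMap (Submonoid.powers (∏ i ∈ F, x i)) M)
      ⟨∏ i ∈ F, x i, Submonoid.mem_powers _⟩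
  have hp : (∏ i ∈ F, x i) = (∏ i ∈ F \ G, x i) * ∏ i ∈ G, x i := (Finset.prod_sdiff h).symm
  have hc : Commute (algebraMap S (Module.End S (CechLoc x M F)) (∏ i ∈ F \ G, x i))
      (algebraMap S (Module.End S (CechLoc x M F)) (∏ i ∈ G, x i)) :=
    Algebra.commute_algebraMap_left _ _
  have hm := map_mul (algebraMap S (Module.End S (CechLoc x M F)))
    (∏ i ∈ F \ G, x i) (∏ i ∈ G, x i)
  have hG := (hc.isUnit_mul_iff.mp (hm ▸ (congrArg
    (algebraMap S (Module.End S (CechLoc x M F))) hp) ▸ hF)).2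
  simpa only [map_pow] using hG.pow m

/-- The canonical map `M_{x_G} → M_{x_F}` for `G ⊆ F`. -/
def cechRestrict {G F : Finset (Fin N)} (h : G ⊆ F) : CechLoc x M G →ₗ[S] CechLoc x M F :=
  LocalizedModule.lift (Submonoid.powers (∏ i ∈ G, x i))
    (LocalizedModule.mkLinearMap (Submonoid.powers (∏ i ∈ F, x i)) M)
    (cechLoc_isUnit x M h)

/-- The module `C^p = ⨁_{|F| = p} M_{x_F}` of the Cech complex of `M` with respect to
`x_1, …, x_N`. -/
abbrev CechCochain (p : ℕ) : Type _ :=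
  (F : {F : Finset (Fin N) // F.card = p}) → CechLoc x M F.1

/-- The differential `C^p → C^{p+1}`,
`(d c)_F = ∑_{i ∈ F} (-1)^{#{j ∈ F, j < i}} c_{F \ {i}}`. -/
def cechD (p : ℕ) : CechCochain x M p →ₗ[S] CechCochain x M (p + 1) :=
  LinearMap.pi fun F =>
    ∑ i : {i // i ∈ F.1},
      ((-1 : S) ^ (F.1.filter (· < i.1)).card) •
        ((cechRestrict x M (Finset.erase_subset i.1 F.1)).comp
          (LinearMap.proj (R := S) (φ := fun E : {E : Finset (Fin N) // E.card = p} =>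
              CechLoc x M E.1)
            ⟨F.1.erase i.1, by rw [Finset.card_erase_of_mem i.2, F.2, Nat.add_sub_cancel]⟩))

/-- The coboundaries in `C^p`. -/
def cechBoundaries : (p : ℕ) → Submodule S (CechCochain x M p)
  | 0 => ⊥
  | p + 1 => LinearMap.range (cechD x M p)

/-- The `p`-th local cohomology module `H^p_{(x_1, …, x_N)}(M)`: the `p`-th cohomology module of
the Cech complex `0 → M → ⨁_i M_{x_i} → ⨁_{i < j} M_{x_i x_j} → ⋯ → M_{x_1 ⋯ x_N} → 0`. -/
abbrev CechCohomology (p : ℕ) : Type _ :=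
  ↥(LinearMap.ker (cechD x M p)) ⧸
    (cechBoundaries x M p).submoduleOf (LinearMap.ker (cechD x M p))

variable (k : Type*) [CommRing k] [Algebra k S] [Module k M] [IsScalarTower k S M]
  (gr : ℕ → Submodule k M)

/-- The degree `ℓ` part of `M_{x_F}`, when `M` is graded by `gr` and every `x_i` has degree `1`:
the elements `a / x_F^m` with `a` homogeneous of degree `ℓ + m |F|`. -/
def cechLocDegree (F : Finset (Fin N)) (ℓ : ℤ) : Submodule k (CechLoc x M F) :=
  Submodule.span k {z | ∃ (d m : ℕ) (a : M), a ∈ gr d ∧ (d : ℤ) = ℓ + m * F.card ∧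
    z = LocalizedModule.mk a ⟨(∏ i ∈ F, x i) ^ m, Submonoid.mem_powers_iff _ _ |>.mpr ⟨m, rfl⟩⟩}

/-- The degree `ℓ` part of `H^p_{(x_1, …, x_N)}(M)`: the classes of the cocycles all of whose
components have degree `ℓ`. -/
def cechCohomologyDegree (p : ℕ) (ℓ : ℤ) : Submodule k (CechCohomology x M p) :=
  ((Submodule.pi Set.univ fun F : {F : Finset (Fin N) // F.card = p} =>
      cechLocDegree x M k gr F.1 ℓ).comap
    ((LinearMap.ker (cechD x M p)).subtype.restrictScalars k)).map
    ((Submodule.mkQ ((cechBoundaries x M p).submoduleOf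
      (LinearMap.ker (cechD x M p)))).restrictScalars k)

end Cech

/-- `F`, a formal Laurent series in `s = t⁻¹`, is the Hilbert series `∑_ℓ dim (A ℓ) t^ℓ` of the
family `A` of graded pieces, all of which are finite-dimensional. -/
def HasHilbertSeriesInv {k H : Type*} [Field k] [AddCommGroup H] [Module k H]
    (A : ℤ → Submodule k H) (F : LaurentSeries ℚ) : Prop :=
  ∀ ℓ : ℤ, FiniteDimensional k (A ℓ) ∧ (Module.finrank k (A ℓ) : ℚ) = F.coeff (-ℓ)

/-- The indeterminate `s = t⁻¹`. -/
def tInv : LaurentSeries ℚ := HahnSeries.single 1 1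

/-! ### Edge ideals -/

section EdgeIdeal

variable (k : Type*) [Field k] {σ : Type*} (G : SimpleGraph σ)

/-- The edge ideal `I(G) = (x_u x_v : {u, v} ∈ E(G))` of `k[V(G)]`. -/
def edgeIdeal : Ideal (MvPolynomial σ k) :=
  Ideal.span {f | ∃ u v, G.Adj u v ∧ f = MvPolynomial.X u * MvPolynomial.X v}

/-- The degree `d` part of `k[V(G)] / I(G)`. -/
def edgeRingDegree (d : ℕ) : Submodule k (MvPolynomial σ k ⧸ edgeIdeal k G) :=
  (MvPolynomial.homogeneousSubmodule σ k d).map (Ideal.Quotient.mkₐ k (edgeIdeal k G)).toLinearMap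

variable [Fintype σ]

/-- The variables of `k[σ]`, listed as `x_1, …, x_N`; they generate the homogeneous maximal
ideal `𝔪`. -/
def polyVars (i : Fin (Fintype.card σ)) : MvPolynomial σ k :=
  MvPolynomial.X ((Fintype.equivFin σ).symm i)

/-- The local cohomology module `H^j_𝔪(k[V(G)] / I(G))`. -/
abbrev EdgeLocalCohomology (j : ℕ) : Type _ :=
  CechCohomology (polyVars k (σ := σ)) (MvPolynomial σ k ⧸ edgeIdeal k G) j

/-- The degree `ℓ` part of `H^j_𝔪(k[V(G)] / I(G))`. -/
def edgeLocalCohomologyDegree (j : ℕ) (ℓ : ℤ) : Submodule k (EdgeLocalCohomology k G j) :=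
  cechCohomologyDegree (polyVars k (σ := σ)) (MvPolynomial σ k ⧸ edgeIdeal k G) k
    (edgeRingDegree k G) j ℓ

end EdgeIdeal

/-! ### Multi-clique-whiskered graphs -/

/-- A clique partition `π = {W_1, …, W_r}` of `G`: the `W_i` are cliques and `V(G)` is their
disjoint union. -/
structure CliquePartition {V : Type*} (G : SimpleGraph V) (r : ℕ) where
  part : Fin r → Finset V
  isClique : ∀ i, G.IsClique (part i : Set V)
  disjoint : ∀ i j, i ≠ j → Disjoint (part i) (part j)
  cover : ∀ v, ∃ i, v ∈ part i

/-- The vertices of `G^π[n_1, …, n_r]`: those of `G` and the `w_{i,k}`, `1 ≤ k ≤ n_i`. -/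
abbrev MultiWhiskerVertex (V : Type*) {r : ℕ} (n : Fin r → ℕ) : Type _ :=
  V ⊕ (Σ i : Fin r, Fin (n i))

/-- The multi-clique-whiskered graph `G^π[n_1, …, n_r]`: the edges are those of `G` and all
`{x, w_{i,k}}` with `x ∈ W_i`. -/
def multiCliqueWhiskered {V : Type*} (G : SimpleGraph V) {r : ℕ} (π : CliquePartition G r)
    (n : Fin r → ℕ) : SimpleGraph (MultiWhiskerVertex V n) where
  Adj
    | .inl u, .inl v => G.Adj u v
    | .inl u, .inr w => u ∈ π.part w.1
    | .inr w, .inl u => u ∈ π.part w.1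
    | .inr _, .inr _ => False
  symm := ⟨by
    rintro (u | w) (v | w') h
    · exact SimpleGraph.Adj.symm h
    · exact h
    · exact h
    · exact h⟩
  loopless := ⟨by
    rintro (u | w) h
    · exact G.loopless.irrefl u h
    · exact h⟩

open Classical in
/-- `Min(G)`: the minimal vertex covers of `G`. -/
def minVertexCovers {σ : Type*} [Fintype σ] (G : SimpleGraph σ) : Finset (Finset σ) :=
  Finset.univ.filter fun C => Minimal (fun D : Finset σ => G.IsVertexCover (D : Set σ)) C

open Classical in
/-- `V(G) \ C`, for a set `C` of vertices of `G^π[n_1, …, n_r]`. -/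
def baseCompl {V : Type*} [Fintype V] {r : ℕ} {n : Fin r → ℕ}
    (C : Finset (MultiWhiskerVertex V n)) : Finset V :=
  Finset.univ.filter fun v => Sum.inl v ∉ C

end

open scoped BigOperators

noncomputable section

/-! ### Cochains on families of finite sets, and toggling -/

section Toggle

variable {ι K : Type*} [LinearOrder ι] [CommRing K]

/-! The Čech complex of an edge ring is multigraded. The localization at `x_F` has a basis of
Laurent monomials `x^a` whose negative coordinates lie in `F` and for which `F ∪ supp a` is
independent (`laurentBasis`), and the differential preserves `a` (`cochainCoef_cechD`). So the
strand in multidegree `a` is the simplicial cochain complex of an order-convex family `P_a` of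
finite sets.

Each strand is computed by a matching in the style of discrete Morse theory. `IsToggle` pairs `F`
with `F ∪ {v}` by a rule that sees only `F ∩ Z`, and every unmatched set is maximal in `P_a`. Each
cocycle is then cohomologous to one supported on unmatched sets (`exists_sub_relCobd`). By
maximality all such cochains are cocycles, and the only coboundary among them is zero
(`relCobd_eq_zero_of_supported`). Hence the dimension of a graded piece is its number of critical
cells (`finrank_edgeLocalCohomologyDegree`), whatever the field.

For the whiskered graph, a positive coordinate of `a` can always be toggled, so only `a ≤ 0`
contributes. There a whisker `w` with `a_w = 0` can be toggled when its clique misses `F`. What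
remains (`map_compl_mem_criticalCells_iff`) are the maximal independent sets `F = V(Γ) \ C` with
exponents `a ≤ 0` supported in `F` and nonzero at every whisker of `F`. With `s = t⁻¹` and `u =
s/(1-s)`, a base vertex of `F` contributes `1/(1-s) = 1 + u` and a whisker contributes `u`. If `F`
has `j` elements, `b` of them in `V(G)`, the product `(1+u)^b u^(j-b)` expands binomially into the
stated sum. -/

/-- The simplicial differential on functions of finite sets. -/
def finsetCobd (f : Finset ι → K) (F : Finset ι) : K :=
  ∑ i ∈ F, (-1) ^ (F.filter (· < i)).card * f (F.erase i)

/-- Deleting the larger element does not change the position of the smaller one, while deleting the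
smaller shifts the larger down by one. The two orders of deletion therefore carry opposite signs. -/
theorem neg_one_pow_card_filter_erase {F : Finset ι} {i j : ι} (hj : j ∈ F) (hij : j < i) :
    ((-1 : K) ^ (F.filter (· < i)).card * (-1) ^ ((F.erase i).filter (· < j)).card) +
      (-1 : K) ^ (F.filter (· < j)).card * (-1) ^ ((F.erase j).filter (· < i)).card = 0 := by
  have h1 : (F.erase i).filter (· < j) = F.filter (· < j) := by
    ext x; simp only [Finset.mem_filter, Finset.mem_erase]
    constructor
    · rintro ⟨⟨_, h⟩, h'⟩; exact ⟨h, h'⟩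
    · rintro ⟨h, h'⟩; exact ⟨⟨(h'.trans hij).ne, h⟩, h'⟩
  have h2 : (F.erase j).filter (· < i) = (F.filter (· < i)).erase j := by
    ext x; simp only [Finset.mem_filter, Finset.mem_erase]; tauto
  have h3 : j ∈ F.filter (· < i) := by simp [hj, hij]
  have h4 := Finset.card_erase_add_one h3
  rw [h1, h2, ← h4, pow_succ]
  ring

theorem finsetCobd_finsetCobd (f : Finset ι → K) (F : Finset ι) :
    finsetCobd (finsetCobd f) F = 0 := by
  simp only [finsetCobd, Finset.mul_sum]
  rw [Finset.sum_sigma']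
  refine Finset.sum_involution (fun p _ => ⟨p.2, p.1⟩) ?_ ?_ ?_ ?_
  · rintro ⟨i, j⟩ h
    simp only [Finset.mem_sigma, Finset.mem_erase] at h
    obtain ⟨hi, hji, hj⟩ := h
    simp only
    rw [Finset.erase_right_comm (a := j) (b := i), ← mul_assoc, ← mul_assoc, ← add_mul]
    rcases lt_or_gt_of_ne hji with h | h
    · rw [neg_one_pow_card_filter_erase hj h, zero_mul]
    · rw [add_comm, neg_one_pow_card_filter_erase hi h, zero_mul]
  · rintro ⟨i, j⟩ h _ h'
    simp only [Finset.mem_sigma, Finset.mem_erase] at h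
    simp only [Sigma.mk.injEq, heq_eq_eq] at h'
    exact h.2.1 h'.1
  · rintro ⟨i, j⟩ h
    simp only [Finset.mem_sigma, Finset.mem_erase] at h ⊢
    exact ⟨h.2.2, h.2.1.symm, h.1⟩
  · rintro ⟨i, j⟩ h
    rfl

open Classical in
/-- The differential on functions supported in a family `P` of finite sets. -/
def relCobd (P : Finset ι → Prop) (f : Finset ι → K) (F : Finset ι) : K :=
  if P F then finsetCobd f F else 0

theorem relCobd_of_not {P : Finset ι → Prop} {f : Finset ι → K} {F : Finset ι} (h : ¬P F) :
    relCobd P f F = 0 := if_neg h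

theorem relCobd_of {P : Finset ι → Prop} {f : Finset ι → K} {F : Finset ι} (h : P F) :
    relCobd P f F = finsetCobd f F := if_pos h

theorem relCobd_sub (P : Finset ι → Prop) (f g : Finset ι → K) (F : Finset ι) :
    relCobd P (fun F => f F - g F) F = relCobd P f F - relCobd P g F := by
  unfold relCobd
  split_ifs
  · simp [finsetCobd, mul_sub]
  · simp

theorem relCobd_add (P : Finset ι → Prop) (f g : Finset ι → K) (F : Finset ι) :
    relCobd P (fun F => f F + g F) F = relCobd P f F + relCobd P g F := by
  unfold relCobd
  split_ifs
  · simp [finsetCobd, mul_add, Finset.sum_add_distrib]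
  · simp

/-- A nonzero value of the differential comes from a facet of codimension one. -/
theorem exists_of_relCobd_ne_zero {P : Finset ι → Prop} {f : Finset ι → K} {F : Finset ι}
    (h : relCobd P f F ≠ 0) : P F ∧ ∃ i ∈ F, f (F.erase i) ≠ 0 := by
  by_cases hP : P F
  · refine ⟨hP, ?_⟩
    rw [relCobd_of hP] at h
    obtain ⟨i, hi, h⟩ := Finset.exists_ne_zero_of_sum_ne_zero h
    exact ⟨i, hi, right_ne_zero_of_mul h⟩
  · exact absurd (relCobd_of_not hP) h

/-- On an order-convex family, the differential squares to zero. -/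
theorem relCobd_relCobd {P : Finset ι → Prop}
    (hconv : ∀ F G H, P F → P H → F ⊆ G → G ⊆ H → P G) {f : Finset ι → K}
    (hf : ∀ F, f F ≠ 0 → P F) (F : Finset ι) : relCobd P (relCobd P f) F = 0 := by
  by_cases hF : P F
  · rw [relCobd_of hF, ← finsetCobd_finsetCobd f F]
    refine Finset.sum_congr rfl fun i hi => ?_
    congr 1
    by_cases hP : P (F.erase i)
    · exact relCobd_of hP
    -- Truncating to `P` loses nothing here: a nonzero value of `f` below `F.erase i` would place
    -- `F.erase i` between two members of `P`.
    · rw [relCobd_of_not hP, eq_comm]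
      refine Finset.sum_eq_zero fun j hj => ?_
      by_contra h
      exact hP (hconv _ _ _ (hf _ (right_ne_zero_of_mul h)) hF (Finset.erase_subset _ _)
        (Finset.erase_subset _ _))
  · exact relCobd_of_not hF

/-- A toggling rule on a convex family `P`: to a set `F` it assigns an element `u (F ∩ Z)` outside
`Z` which may be added to and removed from `F` without leaving `P`, or no element at all, and the
latter happens in `P` only for maximal members. -/
structure IsToggle (P : Finset ι → Prop) (Z : Finset ι) (u : Finset ι → Option ι) : Prop where
  convex : ∀ F G H, P F → P H → F ⊆ G → G ⊆ H → P G
  notMem : ∀ F v, u (F ∩ Z) = some v → v ∉ Z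
  insert_mem : ∀ F v, P F → u (F ∩ Z) = some v → P (insert v F)
  erase_mem : ∀ F v, P F → u (F ∩ Z) = some v → P (F.erase v)
  maximal : ∀ F i, P F → u (F ∩ Z) = none → i ∉ F → ¬P (insert i F)

namespace IsToggle

variable {P : Finset ι → Prop} {Z : Finset ι} {u : Finset ι → Option ι}

/-- The correction is built by induction on the strata `(F ∩ Z).card = m`. Within a stratum,
deleting an element outside `Z` keeps the toggle, and deleting an element of `Z` drops to a stratum
already treated. -/
theorem exists_sub_relCobd_lt (h : IsToggle P Z u) {f : Finset ι → K} {p : ℕ}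
    (hf : ∀ F, f F ≠ 0 → P F ∧ F.card = p)
    (hd : ∀ F, u (F ∩ Z) ≠ none → relCobd P f F = 0) (m : ℕ) :
    ∃ b : Finset ι → K, (∀ F, b F ≠ 0 → P F ∧ F.card + 1 = p) ∧
      ∀ F, u (F ∩ Z) ≠ none → (F ∩ Z).card < m → f F - relCobd P b F = 0 := by
  classical
  induction m with
  | zero => exact ⟨fun _ => 0, by simp, by simp⟩
  | succ m ih =>
    obtain ⟨b, hb, hm⟩ := ih
    set g : Finset ι → K := fun F => f F - relCobd P b F with hg
    have hgs : ∀ F, g F ≠ 0 → P F ∧ F.card = p := by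
      intro F hF
      by_cases hf0 : f F = 0
      · have : relCobd P b F ≠ 0 := by
          intro h0; exact hF (by simp [hg, hf0, h0])
        obtain ⟨hP, i, hi, hbi⟩ := exists_of_relCobd_ne_zero this
        refine ⟨hP, ?_⟩
        rw [← (hb _ hbi).2, Finset.card_erase_add_one hi]
      · exact hf F hf0
    have hgd : ∀ F, u (F ∩ Z) ≠ none → relCobd P g F = 0 := by
      intro F hF
      rw [hg, relCobd_sub, hd F hF, relCobd_relCobd h.convex (fun F hF => (hb F hF).1), sub_zero]
    -- The contracting homotopy of the matching on stratum `m`: a set lacking its toggle receives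
    -- the signed value of `g` at its partner.
    let b' : Finset ι → K := fun F =>
      match u (F ∩ Z) with
      | none => 0
      | some v => if v ∉ F ∧ (F ∩ Z).card = m then
          (-1) ^ ((insert v F).filter (· < v)).card * g (insert v F) else 0
    have hb'some : ∀ F v, u (F ∩ Z) = some v → b' F = if v ∉ F ∧ (F ∩ Z).card = m then
          (-1) ^ ((insert v F).filter (· < v)).card * g (insert v F) else 0 := by
      intro F v hv
      simp only [b', hv]
    have hb'ne : ∀ F, b' F ≠ 0 → ∃ v, u (F ∩ Z) = some v ∧ v ∉ F ∧ (F ∩ Z).card = m ∧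
        g (insert v F) ≠ 0 := by
      intro F hF
      rcases hv : u (F ∩ Z) with _ | v
      · simp [b', hv] at hF
      · rw [hb'some F v hv] at hF
        split_ifs at hF with hc
        · exact ⟨v, rfl, hc.1, hc.2, right_ne_zero_of_mul hF⟩
        · exact absurd rfl hF
    have insZ : ∀ F v, v ∉ Z → (insert v F) ∩ Z = F ∩ Z := by
      intro F v hv; rw [Finset.insert_inter_of_notMem hv]
    have eraZ : ∀ F v, v ∉ Z → (F.erase v) ∩ Z = F ∩ Z := by
      intro F v hv
      rw [Finset.erase_inter, Finset.erase_eq_of_notMem (by simp [hv])]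
    have hb's : ∀ F, b' F ≠ 0 → P F ∧ F.card + 1 = p := by
      intro F hF
      obtain ⟨v, hv, hvF, _, hgv⟩ := hb'ne F hF
      obtain ⟨h1, h2⟩ := hgs _ hgv
      rw [Finset.card_insert_of_notMem hvF] at h2
      refine ⟨?_, h2⟩
      have := h.erase_mem (insert v F) v h1 (by rw [insZ F v (h.notMem F v hv), hv])
      rwa [Finset.erase_insert hvF] at this
    -- The new correction leaves lower strata untouched, since deletion cannot enlarge `F ∩ Z`.
    have hlow : ∀ F, (F ∩ Z).card < m → relCobd P b' F = 0 := by
      intro F hF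
      by_contra hne
      obtain ⟨_, i, hi, hbi⟩ := exists_of_relCobd_ne_zero hne
      obtain ⟨_, _, _, hc, _⟩ := hb'ne _ hbi
      have := Finset.card_le_card
        (Finset.inter_subset_inter_right (u := Z) (Finset.erase_subset i F))
      omega
    -- For sets containing their toggle `v`, only the deletion of `v` contributes to the
    -- differential of `b'`. Other deletions leave the stratum or keep `v`, and `b'` vanishes on
    -- both kinds of set.
    have hmem : ∀ F v, u (F ∩ Z) = some v → v ∈ F → (F ∩ Z).card = m →
        g F - relCobd P b' F = 0 := by
      intro F v hv hvF hc
      have hvZ := h.notMem F v hv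
      by_cases hP : P F
      · rw [relCobd_of hP, finsetCobd, Finset.sum_eq_single v]
        · rw [hb'some (F.erase v) v (by rw [eraZ F v hvZ, hv]), if_pos ⟨by simp, by rw [eraZ F v hvZ, hc]⟩,
            Finset.insert_erase hvF, ← mul_assoc, ← mul_pow]
          simp
        · intro i hi hiv
          by_cases hbi : b' (F.erase i) = 0
          · rw [hbi, mul_zero]
          · exfalso
            obtain ⟨v', hv', hv'F, hc', _⟩ := hb'ne _ hbi
            have hiZ : i ∉ Z := by
              intro hiZ
              rw [Finset.erase_inter, Finset.card_erase_of_mem (by simp [hi, hiZ]), hc] at hc'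
              have : 0 < (F ∩ Z).card := Finset.card_pos.2 ⟨i, by simp [hi, hiZ]⟩
              omega
            rw [eraZ F i hiZ, hv] at hv'
            obtain rfl := Option.some.inj hv'
            exact hv'F (by simp [hvF, Ne.symm hiv])
        · intro h'; exact absurd hvF h'
      · rw [relCobd_of_not hP, sub_zero]
        by_contra hne
        exact hP (hgs F hne).1
    -- For sets lacking `v`, the differential of the corrected cochain is zero at `insert v F`. All
    -- its terms but the one at `F` vanish: by maximality if the face has no toggle, by induction in
    -- a lower stratum, or by `hmem`.
    have hnot : ∀ F v, u (F ∩ Z) = some v → v ∉ F → (F ∩ Z).card = m →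
        g F - relCobd P b' F = 0 := by
      intro F v hv hvF hc
      have hvZ := h.notMem F v hv
      by_cases hP : P F
      · have hP' := h.insert_mem F v hP hv
        have h0 : relCobd P (fun F => g F - relCobd P b' F) (insert v F) = 0 := by
          rw [relCobd_sub, hgd _ (by rw [insZ F v hvZ, hv]; simp),
            relCobd_relCobd h.convex (fun F hF => (hb's F hF).1), sub_zero]
        rw [relCobd_of hP', finsetCobd, Finset.sum_eq_single v] at h0
        · rw [Finset.erase_insert hvF] at h0
          exact (IsUnit.mul_right_eq_zero ((isUnit_one.neg).pow _)).1 h0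
        · intro i hi hiv
          have hiF : i ∈ F := (Finset.mem_insert.1 hi).resolve_left hiv
          rw [mul_eq_zero_of_right]
          have hvG : v ∈ (insert v F).erase i := by simp [Ne.symm hiv]
          rcases hGu : u ((insert v F).erase i ∩ Z) with _ | v'
          · by_contra hne
            have hPG : P ((insert v F).erase i) := by
              by_contra hPG
              refine hne ?_
              rw [relCobd_of_not hPG, sub_zero]
              by_contra hne'
              exact hPG (hgs _ hne').1
            refine h.maximal _ i hPG hGu (by simp) ?_
            rwa [Finset.insert_erase hi]
          · by_cases hiZ : i ∈ Z
            · have hlt : ((insert v F).erase i ∩ Z).card < m := by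
                rw [Finset.erase_inter, insZ F v hvZ, Finset.card_erase_of_mem (by simp [hiF, hiZ]), hc]
                have : 0 < (F ∩ Z).card := Finset.card_pos.2 ⟨i, by simp [hiF, hiZ]⟩
                omega
              rw [hlow _ hlt, sub_zero]
              exact hm _ (by rw [hGu]; simp) hlt
            · have e1 : (insert v F).erase i ∩ Z = F ∩ Z := by rw [eraZ _ i hiZ, insZ F v hvZ]
              exact hmem _ v (by rw [e1, hv]) hvG (by rw [e1, hc])
        · intro h'; exact absurd (Finset.mem_insert_self v F) h'
      · rw [relCobd_of_not hP, sub_zero]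
        by_contra hne
        exact hP (hgs F hne).1
    refine ⟨fun F => b F + b' F, ?_, ?_⟩
    · intro F hF
      by_cases hbF : b F = 0
      · exact hb's F (by intro h0; exact hF (by simp [hbF, h0]))
      · exact hb F hbF
    · intro F hF hlt
      rw [relCobd_add, ← sub_sub]
      change g F - relCobd P b' F = 0
      rcases Nat.lt_succ_iff_lt_or_eq.1 hlt with hlt | heq
      · rw [hlow F hlt, sub_zero]; exact hm F hF hlt
      · obtain ⟨v, hv⟩ := Option.ne_none_iff_exists'.1 hF
        by_cases hvF : v ∈ F
        · exact hmem F v hv hvF heq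
        · exact hnot F v hv hvF heq

/-- A cochain whose differential is supported on the sets without toggle is cohomologous to a
cochain supported on such sets. -/
theorem exists_sub_relCobd (h : IsToggle P Z u) {f : Finset ι → K} {p : ℕ}
    (hf : ∀ F, f F ≠ 0 → P F ∧ F.card = p)
    (hd : ∀ F, u (F ∩ Z) ≠ none → relCobd P f F = 0) :
    ∃ b : Finset ι → K, (∀ F, b F ≠ 0 → P F ∧ F.card + 1 = p) ∧
      ∀ F, u (F ∩ Z) ≠ none → f F - relCobd P b F = 0 := by
  obtain ⟨b, hb, hb'⟩ := h.exists_sub_relCobd_lt hf hd (Z.card + 1)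
  exact ⟨b, hb, fun F hF => hb' F hF
    (Nat.lt_succ_of_le (Finset.card_le_card Finset.inter_subset_right))⟩

/-- The differential of a cochain supported on the sets without toggle vanishes. -/
theorem relCobd_eq_zero (h : IsToggle P Z u) {f : Finset ι → K}
    (hf : ∀ F, f F ≠ 0 → P F ∧ u (F ∩ Z) = none) (F : Finset ι) : relCobd P f F = 0 := by
  by_contra hne
  obtain ⟨hP, i, hi, hfi⟩ := exists_of_relCobd_ne_zero hne
  obtain ⟨hPi, hu⟩ := hf _ hfi
  -- The untoggled set `F.erase i` would extend to `F` inside `P`, against its maximality.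
  refine h.maximal _ i hPi hu (by simp) ?_
  rwa [Finset.insert_erase hi]

/-- A coboundary supported on the sets without toggle vanishes. -/
theorem relCobd_eq_zero_of_supported (h : IsToggle P Z u) {b : Finset ι → K} {p : ℕ}
    (hb : ∀ F, b F ≠ 0 → P F ∧ F.card = p)
    (hd : ∀ F, u (F ∩ Z) ≠ none → relCobd P b F = 0) (F : Finset ι) : relCobd P b F = 0 := by
  obtain ⟨c, hc, hc'⟩ := h.exists_sub_relCobd hb hd
  -- Subtracting a coboundary moves `b` onto untoggled sets without changing its differential, which
  -- vanishes there.
  have h1 : relCobd P (fun F => b F - relCobd P c F) F = 0 := by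
    refine h.relCobd_eq_zero (fun G hG => ⟨?_, ?_⟩) F
    · by_contra hP
      refine hG ?_
      rw [relCobd_of_not hP, sub_zero]
      by_contra hne
      exact hP (hb G hne).1
    · by_contra hne
      exact hG (hc' G hne)
  rwa [relCobd_sub, relCobd_relCobd h.convex (fun F hF => (hc F hF).1), sub_zero] at h1

end IsToggle

end Toggle

/-! ### Laurent monomials in the localizations of an edge ring -/

section LaurentMonomials

variable (k : Type*) [Field k] {σ : Type*} (G : SimpleGraph σ)

theorem edgeIdeal_eq_span_monomial : edgeIdeal k G = Ideal.span
    ((fun s : σ →₀ ℕ => MvPolynomial.monomial s (1 : k)) ''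
      {s | ∃ u v, G.Adj u v ∧ s = Finsupp.single u 1 + Finsupp.single v 1}) := by
  unfold edgeIdeal
  congr 1
  ext f
  constructor
  · rintro ⟨u, v, h, rfl⟩
    exact ⟨_, ⟨u, v, h, rfl⟩, by simp [MvPolynomial.X, MvPolynomial.monomial_mul]⟩
  · rintro ⟨_, ⟨u, v, h, rfl⟩, rfl⟩
    exact ⟨u, v, h, by simp [MvPolynomial.X, MvPolynomial.monomial_mul]⟩

/-- Membership in a monomial ideal is tested term by term, and as the generators are squarefree only
the support of each exponent matters. -/
theorem mem_edgeIdeal_iff {f : MvPolynomial σ k} :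
    f ∈ edgeIdeal k G ↔ ∀ m ∈ f.support, ∃ u v, G.Adj u v ∧ m u ≠ 0 ∧ m v ≠ 0 := by
  classical
  rw [edgeIdeal_eq_span_monomial, MvPolynomial.mem_ideal_span_monomial_image]
  refine forall₂_congr fun m _ => ?_
  constructor
  · rintro ⟨_, ⟨u, v, h, rfl⟩, hle⟩
    have hu := hle u
    have hv := hle v
    simp only [Finsupp.add_apply, Finsupp.single_eq_same] at hu hv
    exact ⟨u, v, h, by omega, by omega⟩
  · rintro ⟨u, v, h, hu, hv⟩
    refine ⟨_, ⟨u, v, h, rfl⟩, fun w => ?_⟩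
    simp only [Finsupp.add_apply, Finsupp.single_apply]
    have := h.ne
    split_ifs with h1 h2 h2
    · exact absurd (h1.trans h2.symm) this
    · subst h1; omega
    · subst h2; omega
    · omega

/-- The ring `k[V(G)] / I(G)`. -/
abbrev EdgeRing : Type _ := MvPolynomial σ k ⧸ edgeIdeal k G

/-- The class of a monomial in the edge ring. -/
def edgeMon (s : σ →₀ ℕ) : EdgeRing k G :=
  Ideal.Quotient.mk (edgeIdeal k G) (MvPolynomial.monomial s 1)

variable {k G} in
theorem monomial_smul_edgeMon (s t : σ →₀ ℕ) :
    (MvPolynomial.monomial s (1 : k)) • edgeMon k G t = edgeMon k G (s + t) := by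
  have h : MvPolynomial.monomial (s + t) (1 : k) =
      MvPolynomial.monomial s 1 * MvPolynomial.monomial t 1 := by
    rw [MvPolynomial.monomial_mul, one_mul]
  rw [edgeMon, edgeMon, h]
  rfl

theorem edgeMon_eq_zero_iff (s : σ →₀ ℕ) :
    edgeMon k G s = 0 ↔ ∃ u v, G.Adj u v ∧ s u ≠ 0 ∧ s v ≠ 0 := by
  classical
  rw [edgeMon, Ideal.Quotient.eq_zero_iff_mem, mem_edgeIdeal_iff]
  simp [MvPolynomial.support_monomial]

variable [Fintype σ]

/-- The exponent of the squarefree monomial `x_F`. -/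
def faceVec (F : Finset (Fin (Fintype.card σ))) : σ →₀ ℕ :=
  Finsupp.equivFunOnFinite.symm fun v => if Fintype.equivFin σ v ∈ F then 1 else 0

theorem faceVec_apply (F : Finset (Fin (Fintype.card σ))) (v : σ) :
    faceVec F v = if Fintype.equivFin σ v ∈ F then 1 else 0 := rfl

theorem prod_polyVars (F : Finset (Fin (Fintype.card σ))) :
    ∏ i ∈ F, polyVars k i = MvPolynomial.monomial (faceVec F) (1 : k) := by
  classical
  rw [MvPolynomial.monomial_eq, map_one, one_mul, Finsupp.prod_fintype _ _ (by simp),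
    ← Equiv.prod_comp (Fintype.equivFin σ).symm]
  simp only [faceVec_apply, Equiv.apply_symm_apply, polyVars, pow_ite, pow_one, pow_zero]
  rw [Finset.prod_ite_mem, Finset.univ_inter]

/-- The localization of the edge ring at `x_F`. -/
abbrev EdgeLoc (F : Finset (Fin (Fintype.card σ))) : Type _ :=
  CechLoc (polyVars k (σ := σ)) (EdgeRing k G) F

/-- The power `x_F ^ m`. -/
def facePow (F : Finset (Fin (Fintype.card σ))) (m : ℕ) :
    Submonoid.powers (∏ i ∈ F, polyVars k (σ := σ) i) :=
  ⟨(∏ i ∈ F, polyVars k i) ^ m, ⟨m, rfl⟩⟩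

theorem facePow_coe (F : Finset (Fin (Fintype.card σ))) (m : ℕ) :
    (facePow k F m : MvPolynomial σ k) = MvPolynomial.monomial (m • faceVec F) 1 := by
  change (∏ i ∈ F, polyVars k i) ^ m = _
  rw [prod_polyVars, MvPolynomial.monomial_pow, one_pow]

theorem exists_eq_facePow (F : Finset (Fin (Fintype.card σ)))
    (s : Submonoid.powers (∏ i ∈ F, polyVars k (σ := σ) i)) : ∃ m, s = facePow k F m := by
  obtain ⟨_, m, rfl⟩ := s
  exact ⟨m, rfl⟩

theorem facePow_smul_edgeMon (F : Finset (Fin (Fintype.card σ))) (m : ℕ) (s : σ →₀ ℕ) :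
    facePow k F m • edgeMon k G s = edgeMon k G (m • faceVec F + s) := by
  rw [Submonoid.smul_def, facePow_coe, monomial_smul_edgeMon]

/-- The fraction `x^s / x_F^m`. -/
def fracMon (F : Finset (Fin (Fintype.card σ))) (s : σ →₀ ℕ) (m : ℕ) : EdgeLoc k G F :=
  LocalizedModule.mk (edgeMon k G s) (facePow k F m)

theorem fracMon_eq_fracMon {F : Finset (Fin (Fintype.card σ))} {s s' : σ →₀ ℕ} {m m' : ℕ}
    (h : ∀ v, m' * faceVec F v + s v = m * faceVec F v + s' v) :
    fracMon k G F s m = fracMon k G F s' m' := by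
  refine LocalizedModule.mk_eq.2 ⟨1, ?_⟩
  rw [facePow_smul_edgeMon, facePow_smul_edgeMon]
  congr 2
  ext v
  simpa using h v

theorem facePow_smul_fracMon (F : Finset (Fin (Fintype.card σ))) (s : σ →₀ ℕ) (m : ℕ) :
    (facePow k F m : MvPolynomial σ k) • fracMon k G F s m =
      LocalizedModule.mkLinearMap _ _ (edgeMon k G s) := by
  rw [fracMon, LocalizedModule.smul'_mk, LocalizedModule.mkLinearMap_apply]
  exact LocalizedModule.mk_cancel (facePow k F m) _

/-- The sum of the absolute values of the coordinates. -/
def absSum (a : σ → ℤ) : ℕ := ∑ v, (a v).natAbs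

/-- The Laurent monomial `x^a` in the localization at `x_F`; meaningful when the negative
coordinates of `a` lie in `F`. -/
def laurentMon (F : Finset (Fin (Fintype.card σ))) (a : σ → ℤ) : EdgeLoc k G F :=
  fracMon k G F (Finsupp.equivFunOnFinite.symm fun v =>
    (a v + (absSum a : ℤ) * faceVec F v).toNat) (absSum a)

theorem add_mul_faceVec_nonneg {F : Finset (Fin (Fintype.card σ))} {a : σ → ℤ} {m : ℕ}
    (ha : ∀ v, a v < 0 → Fintype.equivFin σ v ∈ F) (hm : absSum a ≤ m) (v : σ) :
    0 ≤ a v + (m : ℤ) * faceVec F v := by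
  have h1 : (a v).natAbs ≤ absSum a :=
    Finset.single_le_sum (f := fun w => (a w).natAbs) (by simp) (Finset.mem_univ v)
  rw [faceVec_apply]
  split_ifs with h
  · push_cast; omega
  · have := mt (ha v) h
    push_cast; omega

/-- A fraction depends only on its net exponent, so the denominator `absSum a` in the definition can
be exchanged for any convenient one. -/
theorem fracMon_eq_laurentMon {F : Finset (Fin (Fintype.card σ))} {a : σ → ℤ} {s : σ →₀ ℕ} {m : ℕ}
    (h : ∀ v, (s v : ℤ) = a v + m * faceVec F v) : fracMon k G F s m = laurentMon k G F a := by
  have ha : ∀ v, a v < 0 → Fintype.equivFin σ v ∈ F := by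
    intro v hv
    by_contra hF
    have := h v
    rw [faceVec_apply, if_neg hF] at this
    push_cast at this; omega
  refine fracMon_eq_fracMon k G fun v => ?_
  have h0 := add_mul_faceVec_nonneg ha le_rfl v
  simp only [Finsupp.equivFunOnFinite_symm_apply_apply]
  zify
  rw [Int.toNat_of_nonneg h0, h v]
  ring

/-- The nonzero Laurent monomials of the localization at `x_F`: the negative coordinates lie in
`F`, and the union of `F` with the support is independent. -/
def IsFaceExp (F : Finset (Fin (Fintype.card σ))) (a : σ → ℤ) : Prop :=
  (∀ v, a v < 0 → Fintype.equivFin σ v ∈ F) ∧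
    ∀ u v, G.Adj u v → ¬((a u ≠ 0 ∨ Fintype.equivFin σ u ∈ F) ∧
      (a v ≠ 0 ∨ Fintype.equivFin σ v ∈ F))

/-- One further factor `x_F` makes the support of the numerator contain `F ∪ supp a`. If that set
contains an edge, the numerator is killed by `x_F`. -/
theorem fracMon_eq_zero {F : Finset (Fin (Fintype.card σ))} {a : σ → ℤ} {s : σ →₀ ℕ} {m : ℕ}
    (h : ∀ v, (s v : ℤ) = a v + m * faceVec F v) (ha : ¬IsFaceExp G F a) :
    fracMon k G F s m = 0 := by
  have hneg : ∀ v, a v < 0 → Fintype.equivFin σ v ∈ F := by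
    intro v hv
    by_contra hF
    have := h v
    rw [faceVec_apply, if_neg hF] at this
    push_cast at this; omega
  have key : edgeMon k G (1 • faceVec F + s) = 0 := by
    rw [edgeMon_eq_zero_iff]
    simp only [IsFaceExp, not_and, not_forall, not_not] at ha
    obtain ⟨u, v, huv, hu, hv⟩ := ha hneg
    have aux : ∀ w, (a w ≠ 0 ∨ Fintype.equivFin σ w ∈ F) → (1 • faceVec F + s) w ≠ 0 := by
      intro w hw
      have := h w
      simp only [one_smul, Finsupp.add_apply, faceVec_apply] at this ⊢
      split_ifs at this ⊢ with hF
      · omega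
      · have := hw.resolve_right hF
        push_cast at *; omega
    exact ⟨u, v, huv, aux u hu, aux v hv⟩
  rw [fracMon, ← LocalizedModule.zero_mk (facePow k F m), LocalizedModule.mk_eq]
  refine ⟨facePow k F 1, ?_⟩
  rw [smul_comm (facePow k F 1), facePow_smul_edgeMon k G F 1 s, key]
  simp

theorem laurentMon_eq_zero {F : Finset (Fin (Fintype.card σ))} {a : σ → ℤ}
    (hneg : ∀ v, a v < 0 → Fintype.equivFin σ v ∈ F) (ha : ¬IsFaceExp G F a) :
    laurentMon k G F a = 0 := by
  refine fracMon_eq_zero k G (a := a) (fun v => ?_) ha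
  simp only [Finsupp.equivFunOnFinite_symm_apply_apply]
  rw [Int.toNat_of_nonneg (add_mul_faceVec_nonneg hneg le_rfl v)]

/-- Multiplication by `x_F ^ m` is injective on the target, and the factorization `x_F = x_(F \ E)
x_E` clears both denominators. -/
theorem cechRestrict_laurentMon {E F : Finset (Fin (Fintype.card σ))} (h : E ⊆ F) {a : σ → ℤ}
    (ha : ∀ v, a v < 0 → Fintype.equivFin σ v ∈ E) :
    cechRestrict (polyVars k) (EdgeRing k G) h (laurentMon k G E a) = laurentMon k G F a := by
  classical
  set m := absSum a with hm
  set s : σ →₀ ℕ := Finsupp.equivFunOnFinite.symm fun v => (a v + (m : ℤ) * faceVec E v).toNat with hs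
  have hsv : ∀ v, (s v : ℤ) = a v + m * faceVec E v := fun v => by
    simp only [hs, Finsupp.equivFunOnFinite_symm_apply_apply]
    rw [Int.toNat_of_nonneg (add_mul_faceVec_nonneg ha le_rfl v)]
  rw [← fracMon_eq_laurentMon k G hsv]
  have hdiff : faceVec F = faceVec (F \ E) + faceVec E := by
    ext v
    simp only [Finsupp.add_apply, faceVec_apply, Finset.mem_sdiff]
    by_cases h1 : Fintype.equivFin σ v ∈ E
    · simp [h1, h h1]
    · simp [h1]
  have hF : ∀ v, ((m • faceVec (F \ E) + s) v : ℕ) = a v + (m : ℤ) * faceVec F v := fun v => by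
    rw [hdiff]
    simp only [Finsupp.add_apply, Finsupp.smul_apply, smul_eq_mul]
    push_cast
    rw [hsv v]; ring
  rw [← fracMon_eq_laurentMon k G hF]
  have hinj := IsLocalizedModule.smul_injective
    (LocalizedModule.mkLinearMap (Submonoid.powers (∏ i ∈ F, polyVars k (σ := σ) i)) (EdgeRing k G))
    (facePow k F m)
  apply hinj
  simp only [Submonoid.smul_def]
  rw [facePow_smul_fracMon, ← map_smul]
  have e1 : (facePow k F m : MvPolynomial σ k) • fracMon k G E s m =
      (MvPolynomial.monomial (m • faceVec (F \ E)) (1 : k)) •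
        (facePow k E m : MvPolynomial σ k) • fracMon k G E s m := by
    rw [smul_smul, facePow_coe, facePow_coe, MvPolynomial.monomial_mul, hdiff, smul_add, one_mul]
  rw [e1, facePow_smul_fracMon, map_smul, cechRestrict, LocalizedModule.mkLinearMap_apply,
    LocalizedModule.lift_mk_one, ← map_smul, monomial_smul_edgeMon]

theorem linearIndependent_laurentMon (F : Finset (Fin (Fintype.card σ))) :
    LinearIndependent k fun a : {a : σ → ℤ // IsFaceExp G F a} => laurentMon k G F a.1 := by
  classical
  rw [linearIndependent_iff']
  intro A c hc a₀ ha₀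
  -- A common denominator exponent for all monomials in the relation.
  set m := ∑ a ∈ A, absSum a.1 with hm
  let s : {a : σ → ℤ // IsFaceExp G F a} → σ →₀ ℕ := fun a =>
    Finsupp.equivFunOnFinite.symm fun v => (a.1 v + (m : ℤ) * faceVec F v).toNat
  have hsv : ∀ a ∈ A, ∀ v, (s a v : ℤ) = a.1 v + m * faceVec F v := fun a ha v => by
    simp only [s, Finsupp.equivFunOnFinite_symm_apply_apply]
    rw [Int.toNat_of_nonneg (add_mul_faceVec_nonneg a.2.1 _ v)]
    exact Finset.single_le_sum (f := fun a : {a : σ → ℤ // IsFaceExp G F a} =>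
      absSum a.1) (by simp) ha
  have h1 : (LocalizedModule.mkLinearMap (Submonoid.powers (∏ i ∈ F, polyVars k (σ := σ) i))
      (EdgeRing k G)) (∑ a ∈ A, c a • edgeMon k G (s a)) = 0 := by
    have h2 := congrArg (fun y => (facePow k F m : MvPolynomial σ k) • y) hc
    simp only [smul_zero, Finset.smul_sum] at h2
    rw [map_sum, ← h2]
    refine Finset.sum_congr rfl fun a ha => ?_
    rw [smul_comm, ← fracMon_eq_laurentMon k G (hsv a ha), facePow_smul_fracMon]
    exact LinearMap.map_smul_of_tower _ (c a) _
  rw [IsLocalizedModule.eq_zero_iff (Submonoid.powers (∏ i ∈ F, polyVars k (σ := σ) i))] at h1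
  obtain ⟨t, ht⟩ := h1
  obtain ⟨n, rfl⟩ := exists_eq_facePow k F t
  have h3 : Ideal.Quotient.mk (edgeIdeal k G)
      (∑ a ∈ A, c a • MvPolynomial.monomial (n • faceVec F + s a) (1 : k)) = 0 := by
    rw [← ht, map_sum, Finset.smul_sum]
    refine Finset.sum_congr rfl fun a ha => ?_
    rw [smul_comm, facePow_smul_edgeMon]
    rfl
  rw [Ideal.Quotient.eq_zero_iff_mem, mem_edgeIdeal_iff] at h3
  by_contra hne
  have hcoeff : (∑ a ∈ A, c a • MvPolynomial.monomial (n • faceVec F + s a) (1 : k)).coeff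
      (n • faceVec F + s a₀) = c a₀ := by
    rw [MvPolynomial.coeff_sum, Finset.sum_eq_single a₀]
    · simp
    · intro a ha hne
      rw [MvPolynomial.coeff_smul, MvPolynomial.coeff_monomial, if_neg, smul_zero]
      intro heq
      refine hne (Subtype.ext (funext fun v => ?_))
      have h4 := hsv a ha v
      have h5 := hsv a₀ ha₀ v
      rw [add_left_cancel heq, h5] at h4
      linarith
    · intro h'; exact absurd ha₀ h'
  -- A nonzero coefficient would force this exponent to contain an edge, although its support lies
  -- in the independent set `F ∪ supp a₀`.
  obtain ⟨u, v, huv, hu, hv⟩ := h3 (n • faceVec F + s a₀) (by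
    rw [MvPolynomial.mem_support_iff, hcoeff]; exact hne)
  have aux : ∀ w, (n • faceVec F + s a₀) w ≠ 0 → a₀.1 w ≠ 0 ∨ Fintype.equivFin σ w ∈ F := by
    intro w hw
    by_contra hcon
    push Not at hcon
    have := hsv a₀ ha₀ w
    simp only [Finsupp.add_apply, Finsupp.smul_apply, faceVec_apply, if_neg hcon.2, hcon.1] at this hw
    simp at this hw
    exact hw this
  exact a₀.2.2 u v huv ⟨aux u hu, aux v hv⟩

/-- Each fraction is either zero or a single Laurent monomial. Recording its degree makes this serve
both the spanning of the whole localization and the description of its graded pieces. -/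
theorem fracMon_mem_span (F : Finset (Fin (Fintype.card σ))) (s : σ →₀ ℕ) (m : ℕ) :
    fracMon k G F s m ∈ Submodule.span k
      ((fun a => laurentMon k G F a) '' {a | IsFaceExp G F a ∧
        ∑ v, a v = (s.degree : ℤ) - m * F.card}) := by
  have h : ∀ v, (s v : ℤ) = ((s v : ℤ) - m * faceVec F v) + m * faceVec F v := fun v => by ring
  by_cases ha : IsFaceExp G F fun v => (s v : ℤ) - m * faceVec F v
  · rw [fracMon_eq_laurentMon k G h]
    refine Submodule.subset_span ⟨_, ⟨ha, ?_⟩, rfl⟩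
    rw [Finset.sum_sub_distrib, ← Finset.mul_sum]
    congr 2
    · rw [Finsupp.degree_eq_sum]; push_cast; rfl
    · rw [← Equiv.sum_comp (Fintype.equivFin σ).symm]
      simp [faceVec_apply]
  · rw [fracMon_eq_zero k G h ha]
    exact Submodule.zero_mem _

theorem mk_mem_span (F : Finset (Fin (Fintype.card σ))) (f : MvPolynomial σ k) (m : ℕ)
    (B : Submodule k (EdgeLoc k G F)) (h : ∀ s ∈ f.support, fracMon k G F s m ∈ B) :
    (LocalizedModule.mk (Ideal.Quotient.mk (edgeIdeal k G) f) (facePow k F m) :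
      EdgeLoc k G F) ∈ B := by
  have hmk : ∀ (A : Finset (σ →₀ ℕ)) (c : (σ →₀ ℕ) → k),
      (LocalizedModule.mk (Ideal.Quotient.mk (edgeIdeal k G)
        (∑ s ∈ A, c s • MvPolynomial.monomial s (1 : k))) (facePow k F m) : EdgeLoc k G F) =
      ∑ s ∈ A, c s • fracMon k G F s m := by
    classical
    intro A c
    induction A using Finset.induction_on with
    | empty => simp
    | insert s A hs ih =>
      rw [Finset.sum_insert hs, Finset.sum_insert hs, ← ih, fracMon, LocalizedModule.smul'_mk,
        LocalizedModule.mk_add_mk, ← smul_add, LocalizedModule.mk_cancel_common_left, map_add]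
      rfl
  have hf : f = ∑ s ∈ f.support, f.coeff s • MvPolynomial.monomial s (1 : k) := by
    conv_lhs => rw [f.as_sum]
    refine Finset.sum_congr rfl fun s _ => ?_
    rw [MvPolynomial.smul_monomial, smul_eq_mul, mul_one]
  rw [hf, hmk]
  exact Submodule.sum_mem _ fun s hs => Submodule.smul_mem _ _ (h s hs)

theorem span_laurentMon (F : Finset (Fin (Fintype.card σ))) :
    ⊤ ≤ Submodule.span k
      (Set.range fun a : {a : σ → ℤ // IsFaceExp G F a} => laurentMon k G F a.1) := by
  rintro y -
  induction y using LocalizedModule.induction_on with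
  | h r t =>
    obtain ⟨m, rfl⟩ := exists_eq_facePow k F t
    obtain ⟨f, rfl⟩ := Ideal.Quotient.mk_surjective r
    refine mk_mem_span k G F f m _ fun s _ => ?_
    refine Submodule.span_mono ?_ (fracMon_mem_span k G F s m)
    rintro _ ⟨a, ha, rfl⟩
    exact ⟨⟨a, ha.1⟩, rfl⟩

/-- The Laurent monomials form a basis of the localization at `x_F`. -/
def laurentBasis (F : Finset (Fin (Fintype.card σ))) :
    Module.Basis {a : σ → ℤ // IsFaceExp G F a} k (EdgeLoc k G F) :=
  Module.Basis.mk (linearIndependent_laurentMon k G F) (span_laurentMon k G F)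

theorem cechLocDegree_eq_span (F : Finset (Fin (Fintype.card σ))) (ℓ : ℤ) :
    cechLocDegree (polyVars k (σ := σ)) (EdgeRing k G) k (edgeRingDegree k G) F ℓ =
      Submodule.span k ((fun a => laurentMon k G F a) '' {a | IsFaceExp G F a ∧ ∑ v, a v = ℓ}) := by
  apply le_antisymm
  · refine Submodule.span_le.2 ?_
    rintro _ ⟨d, m, _, ⟨f, hf, rfl⟩, hd, rfl⟩
    refine mk_mem_span k G F f m _ fun s hs => ?_
    have hdeg : s.degree = d := by
      have := (MvPolynomial.mem_homogeneousSubmodule d f).1 hf (MvPolynomial.mem_support_iff.1 hs)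
      rw [Finsupp.degree_eq_weight_one]
      exact this
    have := fracMon_mem_span k G F s m
    rwa [hdeg, hd, add_sub_cancel_right] at this
  · refine Submodule.span_le.2 ?_
    rintro _ ⟨a, ⟨ha, hℓ⟩, rfl⟩
    refine Submodule.subset_span ?_
    refine ⟨_, _, _, ⟨_, MvPolynomial.isHomogeneous_monomial (1 : k) rfl, rfl⟩, ?_, rfl⟩
    rw [Finsupp.degree_eq_sum]
    simp only [Finsupp.equivFunOnFinite_symm_apply_apply]
    push_cast
    rw [← hℓ, Finset.sum_congr rfl fun v _ => Int.toNat_of_nonneg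
      (add_mul_faceVec_nonneg ha.1 le_rfl v), Finset.sum_add_distrib, ← Finset.mul_sum]
    congr 2
    rw [← Equiv.sum_comp (Fintype.equivFin σ).symm]
    simp [faceVec_apply]

end LaurentMonomials

/-! ### The cohomology of the Cech complex of an edge ring -/

section CechCoefficients

variable (k : Type*) [Field k] {σ : Type*} (G : SimpleGraph σ) [Fintype σ]

/-- The coefficients of an element of the localization at `x_F` with respect to the Laurent
monomials. -/
def coefLoc (F : Finset (Fin (Fintype.card σ))) : EdgeLoc k G F →ₗ[k] ((σ → ℤ) →₀ k) :=
  Finsupp.lmapDomain k k Subtype.val ∘ₗ (laurentBasis k G F).repr.toLinearMap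

variable {G} in
theorem coefLoc_laurentMon {F : Finset (Fin (Fintype.card σ))} {a : σ → ℤ} (h : IsFaceExp G F a) :
    coefLoc k G F (laurentMon k G F a) = Finsupp.single a 1 := by
  have : laurentMon k G F a = laurentBasis k G F ⟨a, h⟩ := by
    rw [laurentBasis, Module.Basis.mk_apply]
  rw [this, coefLoc, LinearMap.comp_apply, LinearEquiv.coe_coe, Module.Basis.repr_self,
    Finsupp.lmapDomain_apply, Finsupp.mapDomain_single]

theorem coefLoc_injective (F : Finset (Fin (Fintype.card σ))) :
    Function.Injective (coefLoc k G F) := by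
  intro y z h
  exact (laurentBasis k G F).repr.injective
    (Finsupp.mapDomain_injective Subtype.val_injective h)

variable {k G}

theorem isFaceExp_of_coefLoc_ne_zero {F : Finset (Fin (Fintype.card σ))} {y : EdgeLoc k G F}
    {a : σ → ℤ} (h : coefLoc k G F y a ≠ 0) : IsFaceExp G F a := by
  by_contra ha
  refine h (Finsupp.mapDomain_of_notMem_range _ _ ?_)
  rintro ⟨b, rfl⟩
  exact ha b.2

theorem sum_coefLoc (F : Finset (Fin (Fintype.card σ))) (y : EdgeLoc k G F) :
    ((coefLoc k G F y).sum fun a c => c • laurentMon k G F a) = y := by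
  rw [coefLoc, LinearMap.comp_apply, Finsupp.lmapDomain_apply,
    Finsupp.sum_mapDomain_index (by simp) (by intros; rw [add_smul])]
  conv_rhs => rw [← (laurentBasis k G F).linearCombination_repr y]
  rw [Finsupp.linearCombination_apply]
  refine Finsupp.sum_congr fun a _ => ?_
  rw [laurentBasis, Module.Basis.mk_apply]

/-- Checked on the basis. The hypothesis on `F` is needed because `x^a` may become zero after
further localization. -/
theorem coefLoc_cechRestrict {E F : Finset (Fin (Fintype.card σ))} (h : E ⊆ F) {a : σ → ℤ}
    (ha : IsFaceExp G F a) (y : EdgeLoc k G E) :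
    coefLoc k G F (cechRestrict (polyVars k) (EdgeRing k G) h y) a = coefLoc k G E y a := by
  classical
  have key : Finsupp.lapply a ∘ₗ coefLoc k G F ∘ₗ
      (cechRestrict (polyVars k) (EdgeRing k G) h).restrictScalars k =
      Finsupp.lapply a ∘ₗ coefLoc k G E := by
    refine (laurentBasis k G E).ext fun b => ?_
    rw [laurentBasis, Module.Basis.mk_apply]
    simp only [LinearMap.comp_apply, LinearMap.restrictScalars_apply, Finsupp.lapply_apply]
    rw [cechRestrict_laurentMon k G h b.2.1, coefLoc_laurentMon k b.2]
    by_cases hb : IsFaceExp G F b.1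
    · rw [coefLoc_laurentMon k hb]
    · rw [laurentMon_eq_zero k G (fun v hv => h (b.2.1 v hv)) hb, map_zero, Finsupp.zero_apply,
        Finsupp.single_apply, if_neg]
      rintro rfl
      exact hb ha
  exact DFunLike.congr_fun key y

theorem mem_cechLocDegree_iff {F : Finset (Fin (Fintype.card σ))} {ℓ : ℤ} {y : EdgeLoc k G F} :
    y ∈ cechLocDegree (polyVars k (σ := σ)) (EdgeRing k G) k (edgeRingDegree k G) F ℓ ↔
      ∀ a, coefLoc k G F y a ≠ 0 → ∑ v, a v = ℓ := by
  rw [cechLocDegree_eq_span]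
  constructor
  · intro hy
    have hle : Submodule.span k ((fun a => laurentMon k G F a) ''
        {a | IsFaceExp G F a ∧ ∑ v, a v = ℓ}) ≤
        (Finsupp.supported k k {a : σ → ℤ | ∑ v, a v = ℓ}).comap (coefLoc k G F) := by
      rw [Submodule.span_le]
      rintro _ ⟨a, ⟨ha, hℓ⟩, rfl⟩
      simp only [Submodule.comap_coe, Set.mem_preimage, SetLike.mem_coe]
      rw [coefLoc_laurentMon k ha]
      exact Finsupp.single_mem_supported k 1 hℓ
    intro a ha
    exact (Finsupp.mem_supported k _).1 (hle hy) (Finsupp.mem_support_iff.2 ha)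
  · intro h
    rw [← sum_coefLoc F y]
    refine Submodule.sum_mem _ fun a ha => Submodule.smul_mem _ _ (Submodule.subset_span ?_)
    have ha := Finsupp.mem_support_iff.1 ha
    exact ⟨a, ⟨isFaceExp_of_coefLoc_ne_zero ha, h a ha⟩, rfl⟩

variable (k G) in
/-- The Cech cochains of the edge ring. -/
abbrev EdgeCochain (p : ℕ) : Type _ := CechCochain (polyVars k (σ := σ)) (EdgeRing k G) p

/-- The coefficient of `x^a` in the `F`-component of a cochain. -/
def cochainCoef {p : ℕ} : EdgeCochain k G p →ₗ[k]
    (Finset (Fin (Fintype.card σ)) → (σ → ℤ) → k) where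
  toFun c F a := if h : F.card = p then coefLoc k G F (c ⟨F, h⟩) a else 0
  map_add' c d := by
    ext F a
    simp only [Pi.add_apply]
    split_ifs <;> simp
  map_smul' t c := by
    ext F a
    simp only [Pi.smul_apply, RingHom.id_apply]
    split_ifs <;> simp

theorem cochainCoef_of {p : ℕ} (c : EdgeCochain k G p) {F : Finset (Fin (Fintype.card σ))}
    (h : F.card = p) (a : σ → ℤ) : cochainCoef c F a = coefLoc k G F (c ⟨F, h⟩) a := dif_pos h

theorem cochainCoef_of_not {p : ℕ} (c : EdgeCochain k G p) {F : Finset (Fin (Fintype.card σ))}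
    (h : F.card ≠ p) (a : σ → ℤ) : cochainCoef c F a = 0 := dif_neg h

theorem cochainCoef_ne_zero {p : ℕ} {c : EdgeCochain k G p} {F : Finset (Fin (Fintype.card σ))}
    {a : σ → ℤ} (h : cochainCoef c F a ≠ 0) : IsFaceExp G F a ∧ F.card = p := by
  by_cases hF : F.card = p
  · rw [cochainCoef_of c hF] at h
    exact ⟨isFaceExp_of_coefLoc_ne_zero h, hF⟩
  · exact absurd (cochainCoef_of_not c hF a) h

theorem cochainCoef_injective {p : ℕ} :
    Function.Injective (cochainCoef : EdgeCochain k G p →ₗ[k] _) := by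
  intro c d h
  funext ⟨F, hF⟩
  refine coefLoc_injective k G F (Finsupp.ext fun a => ?_)
  have := congrFun (congrFun h F) a
  rwa [cochainCoef_of c hF, cochainCoef_of d hF] at this

theorem finite_cochainCoef_ne_zero {p : ℕ} (c : EdgeCochain k G p) :
    {a | ∃ F, cochainCoef c F a ≠ 0}.Finite := by
  have : {a | ∃ F, cochainCoef c F a ≠ 0} ⊆
      ⋃ F : {F : Finset (Fin (Fintype.card σ)) // F.card = p},
        ((coefLoc k G F.1 (c F)).support : Set (σ → ℤ)) := by
    rintro a ⟨F, h⟩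
    have hF := (cochainCoef_ne_zero h).2
    rw [cochainCoef_of c hF] at h
    exact Set.mem_iUnion.2 ⟨⟨F, hF⟩, Finsupp.mem_support_iff.2 h⟩
  exact (Set.finite_iUnion fun F => Finset.finite_toSet _).subset this

/-- Together with injectivity, this allows cochains to be built one multidegree at a time, provided
only finitely many multidegrees occur. -/
theorem exists_cochainCoef_eq {p : ℕ} (g : Finset (Fin (Fintype.card σ)) → (σ → ℤ) → k)
    (hg : ∀ F a, g F a ≠ 0 → IsFaceExp G F a ∧ F.card = p) (hfin : {a | ∃ F, g F a ≠ 0}.Finite) :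
    ∃ c : EdgeCochain k G p, cochainCoef c = g := by
  classical
  refine ⟨fun F => ∑ a ∈ hfin.toFinset, g F.1 a • laurentMon k G F.1 a, ?_⟩
  ext F a
  by_cases hF : F.card = p
  · rw [cochainCoef_of _ hF, map_sum, Finsupp.finsetSum_apply]
    have : ∀ b ∈ hfin.toFinset, coefLoc k G F (g F b • laurentMon k G F b) a =
        if b = a then g F a else 0 := by
      intro b _
      rw [map_smul, Finsupp.smul_apply]
      by_cases hb : g F b = 0
      · rw [hb, zero_smul]
        split_ifs with h
        · rw [← h, hb]
        · rfl
      · rw [coefLoc_laurentMon k (hg F b hb).1, Finsupp.single_apply]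
        split_ifs with h
        · rw [h]; simp
        · simp
    rw [Finset.sum_congr rfl this, Finset.sum_ite_eq']
    split_ifs with h
    · rfl
    · by_contra hne
      exact h (hfin.mem_toFinset.2 ⟨F, Ne.symm hne⟩)
  · rw [cochainCoef_of_not _ hF]
    by_contra hne
    exact hF (hg F a (Ne.symm hne)).2

theorem neg_one_pow_smul_edgeLoc {F : Finset (Fin (Fintype.card σ))} (m : ℕ) (y : EdgeLoc k G F) :
    ((-1 : MvPolynomial σ k) ^ m) • y = ((-1 : k) ^ m) • y := by
  rcases Nat.even_or_odd m with hm | hm <;> simp [hm.neg_one_pow]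

/-- This splits the Čech complex into its multigraded strands and reduces its cohomology to the
combinatorics of `relCobd`. -/
theorem cochainCoef_cechD {p : ℕ} (c : EdgeCochain k G p) (F : Finset (Fin (Fintype.card σ)))
    (a : σ → ℤ) : cochainCoef (cechD (polyVars k) (EdgeRing k G) p c : EdgeCochain k G (p + 1)) F a =
      relCobd (fun E => IsFaceExp G E a) (fun E => cochainCoef c E a) F := by
  by_cases ha : IsFaceExp G F a
  · rw [relCobd_of ha]
    by_cases hF : F.card = p + 1
    · rw [cochainCoef_of _ hF, finsetCobd, cechD, LinearMap.pi_apply, LinearMap.sum_apply, map_sum,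
        Finsupp.finsetSum_apply, ← Finset.sum_coe_sort F]
      refine Finset.sum_congr rfl fun i _ => ?_
      rw [LinearMap.smul_apply, neg_one_pow_smul_edgeLoc, map_smul, Finsupp.smul_apply,
        LinearMap.comp_apply, LinearMap.proj_apply, coefLoc_cechRestrict _ ha,
        cochainCoef_of c (by rw [Finset.card_erase_of_mem i.2, hF, Nat.add_sub_cancel]), smul_eq_mul]
    · rw [cochainCoef_of_not _ hF, eq_comm]
      refine Finset.sum_eq_zero fun i hi => ?_
      by_contra hne
      refine hF ?_
      rw [← (cochainCoef_ne_zero (right_ne_zero_of_mul hne)).2, Finset.card_erase_add_one hi]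
  · rw [relCobd_of_not ha]
    by_contra hne
    exact ha (cochainCoef_ne_zero hne).1

theorem isFaceExp_convex (a : σ → ℤ) (E F H : Finset (Fin (Fintype.card σ)))
    (hE : IsFaceExp G E a) (hH : IsFaceExp G H a) (hEF : E ⊆ F) (hFH : F ⊆ H) :
    IsFaceExp G F a :=
  ⟨fun v hv => hEF (hE.1 v hv), fun u v huv h => hH.2 u v huv
    ⟨h.1.imp_right fun h => hFH h, h.2.imp_right fun h => hFH h⟩⟩

end CechCoefficients

/-! ### Critical cells form a basis of local cohomology -/

section Critical

variable {k : Type*} [Field k] {σ : Type*} {G : SimpleGraph σ} [Fintype σ]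
  (Z : (σ → ℤ) → Finset (Fin (Fintype.card σ)))
  (u : (σ → ℤ) → Finset (Fin (Fintype.card σ)) → Option (Fin (Fintype.card σ)))

variable (G) in
/-- The critical Laurent monomials of cohomological degree `p` and degree `ℓ`, for a toggling
rule given in every multidegree. -/
def criticalCells (p : ℕ) (ℓ : ℤ) : Set (Finset (Fin (Fintype.card σ)) × (σ → ℤ)) :=
  {b | b.1.card = p ∧ IsFaceExp G b.1 b.2 ∧ u b.2 (b.1 ∩ Z b.2) = none ∧ ∑ v, b.2 v = ℓ}

variable {Z u}

open Classical in
theorem exists_cochainCoef_critical (p : ℕ) (ℓ : ℤ) (b : criticalCells G Z u p ℓ) :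
    ∃ c : EdgeCochain k G p, cochainCoef c = fun F a => if b.1 = (F, a) then 1 else 0 := by
  refine exists_cochainCoef_eq _ (fun F a h => ?_) ?_
  · have hb : b.1 = (F, a) := by
      by_contra hne; exact h (if_neg hne)
    have h1 := b.2
    rw [hb] at h1
    exact ⟨h1.2.1, h1.1⟩
  · refine (Set.finite_singleton b.1.2).subset ?_
    rintro a ⟨F, h⟩
    have hb : b.1 = (F, a) := by
      by_contra hne; exact h (if_neg hne)
    rw [hb]
    rfl

variable (k) in
/-- The cochain consisting of a single critical Laurent monomial. -/
def criticalCochain (p : ℕ) (ℓ : ℤ) (b : criticalCells G Z u p ℓ) : EdgeCochain k G p :=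
  (exists_cochainCoef_critical p ℓ b).choose

open Classical in
theorem cochainCoef_criticalCochain (p : ℕ) (ℓ : ℤ) (b : criticalCells G Z u p ℓ)
    (F : Finset (Fin (Fintype.card σ))) (a : σ → ℤ) :
    cochainCoef (criticalCochain k p ℓ b) F a = if b.1 = (F, a) then 1 else 0 := by
  rw [criticalCochain, (exists_cochainCoef_critical p ℓ b).choose_spec]

theorem sum_criticalCochain {p : ℕ} {ℓ : ℤ} [Fintype (criticalCells G Z u p ℓ)]
    {c : EdgeCochain k G p}
    (hc : ∀ F a, cochainCoef c F a ≠ 0 → (F, a) ∈ criticalCells G Z u p ℓ) :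
    ∑ b : criticalCells G Z u p ℓ, cochainCoef c b.1.1 b.1.2 • criticalCochain k p ℓ b = c := by
  classical
  refine cochainCoef_injective (funext fun F => funext fun a => ?_)
  rw [map_sum]
  simp only [Finset.sum_apply, map_smul, Pi.smul_apply, cochainCoef_criticalCochain, smul_eq_mul,
    mul_ite, mul_one, mul_zero]
  by_cases h : cochainCoef c F a = 0
  · rw [h]
    refine Finset.sum_eq_zero fun b _ => ?_
    split_ifs with hb
    · rw [hb, h]
    · rfl
  · rw [Finset.sum_eq_single ⟨(F, a), hc F a h⟩]
    · simp
    · intro b _ hb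
      rw [if_neg]
      intro hb'
      exact hb (Subtype.ext hb')
    · simp

theorem criticalCochain_mem_ker (hT : ∀ a, IsToggle (fun F => IsFaceExp G F a) (Z a) (u a))
    (p : ℕ) (ℓ : ℤ) (b : criticalCells G Z u p ℓ) :
    criticalCochain k p ℓ b ∈ LinearMap.ker (cechD (polyVars k) (EdgeRing k G) p) := by
  rw [LinearMap.mem_ker]
  refine cochainCoef_injective (funext fun F => funext fun a => ?_)
  rw [cochainCoef_cechD, map_zero]
  refine (hT a).relCobd_eq_zero (fun E hE => ?_) F
  rw [cochainCoef_criticalCochain] at hE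
  have hb : b.1 = (E, a) := by
    by_contra hne; exact hE (if_neg hne)
  have h1 := b.2
  rw [hb] at h1
  exact ⟨h1.2.1, h1.2.2.1⟩

variable (k) in
/-- The class of a critical Laurent monomial in the local cohomology module. -/
def criticalClass (hT : ∀ a, IsToggle (fun F => IsFaceExp G F a) (Z a) (u a)) (p : ℕ) (ℓ : ℤ)
    (b : criticalCells G Z u p ℓ) : EdgeLocalCohomology k G p :=
  Submodule.Quotient.mk ⟨criticalCochain k p ℓ b, criticalCochain_mem_ker hT p ℓ b⟩

theorem sum_smul_criticalClass (hT : ∀ a, IsToggle (fun F => IsFaceExp G F a) (Z a) (u a)) (p : ℕ)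
    (ℓ : ℤ) [Fintype (criticalCells G Z u p ℓ)] (g : criticalCells G Z u p ℓ → k) :
    ∑ b, g b • criticalClass k hT p ℓ b = Submodule.Quotient.mk
      (∑ b, g b • ⟨criticalCochain k p ℓ b, criticalCochain_mem_ker hT p ℓ b⟩) := by
  have := map_sum ((Submodule.mkQ ((cechBoundaries (polyVars k (σ := σ)) (EdgeRing k G) p).submoduleOf
      (LinearMap.ker (cechD (polyVars k (σ := σ)) (EdgeRing k G) p)))).restrictScalars k)
    (fun b => g b • (⟨criticalCochain k p ℓ b, criticalCochain_mem_ker hT p ℓ b⟩ :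
      LinearMap.ker (cechD (polyVars k (σ := σ)) (EdgeRing k G) p))) Finset.univ
  refine Eq.trans ?_ this.symm
  exact Finset.sum_congr rfl fun b _ => rfl

theorem coe_sum_smul_ker {p : ℕ} {ι : Type*} (s : Finset ι) (g : ι → k)
    (c : ι → LinearMap.ker (cechD (polyVars k (σ := σ)) (EdgeRing k G) p)) :
    ((∑ b ∈ s, g b • c b : LinearMap.ker (cechD (polyVars k (σ := σ)) (EdgeRing k G) p)) :
      EdgeCochain k G p) = ∑ b ∈ s, g b • (c b : EdgeCochain k G p) := by
  have := map_sum ((LinearMap.ker (cechD (polyVars k (σ := σ)) (EdgeRing k G) p)).subtype.restrictScalars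
    k) (fun b => g b • c b) s
  exact this

/-- A linear relation says that a combination of critical monomials is a coboundary. In every
multidegree it is supported on untoggled sets, hence zero, and its coefficients can be read off. -/
theorem linearIndependent_criticalClass
    (hT : ∀ a, IsToggle (fun F => IsFaceExp G F a) (Z a) (u a)) (p : ℕ) (ℓ : ℤ)
    [Fintype (criticalCells G Z u (p + 1) ℓ)] :
    LinearIndependent k (criticalClass k hT (p + 1) ℓ) := by
  classical
  rw [Fintype.linearIndependent_iff]
  intro g hg b₀
  rw [sum_smul_criticalClass, Submodule.Quotient.mk_eq_zero] at hg
  obtain ⟨β, hβ⟩ := hg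
  have hβ' : cechD (polyVars k (σ := σ)) (EdgeRing k G) p β =
      ∑ b, g b • criticalCochain k (p + 1) ℓ b := hβ.trans (coe_sum_smul_ker _ _ _)
  have h1 : ∀ F a, relCobd (fun E => IsFaceExp G E a) (fun E => cochainCoef β E a) F =
      ∑ b : criticalCells G Z u (p + 1) ℓ, if b.1 = (F, a) then g b else 0 := by
    intro F a
    rw [← cochainCoef_cechD, hβ', map_sum]
    simp only [Finset.sum_apply, map_smul, Pi.smul_apply, cochainCoef_criticalCochain, smul_eq_mul,
      mul_ite, mul_one, mul_zero]
  have h2 : ∀ F a, relCobd (fun E => IsFaceExp G E a) (fun E => cochainCoef β E a) F = 0 := by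
    intro F a
    refine (hT a).relCobd_eq_zero_of_supported (p := p) (fun E hE => cochainCoef_ne_zero hE)
      (fun E hE => ?_) F
    rw [h1]
    refine Finset.sum_eq_zero fun b _ => if_neg fun hb => hE ?_
    have h3 := b.2
    rw [hb] at h3
    exact h3.2.2.1
  have h3 := h1 b₀.1.1 b₀.1.2
  rw [h2, Finset.sum_eq_single b₀] at h3
  · simpa using h3.symm
  · intro b _ hb
    exact if_neg fun hb' => hb (Subtype.ext hb')
  · simp

theorem mem_edgeLocalCohomologyDegree_iff {p : ℕ} {ℓ : ℤ} {y : EdgeLocalCohomology k G p} :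
    y ∈ edgeLocalCohomologyDegree k G p ℓ ↔
      ∃ z : LinearMap.ker (cechD (polyVars k (σ := σ)) (EdgeRing k G) p),
        (∀ F a, cochainCoef (z : EdgeCochain k G p) F a ≠ 0 → ∑ v, a v = ℓ) ∧
          Submodule.Quotient.mk z = y := by
  constructor
  · rintro ⟨z, hz, rfl⟩
    refine ⟨z, fun F a h => ?_, rfl⟩
    have hF := (cochainCoef_ne_zero h).2
    rw [cochainCoef_of _ hF] at h
    exact mem_cechLocDegree_iff.1 (hz ⟨F, hF⟩ (Set.mem_univ _)) a h
  · rintro ⟨z, hz, rfl⟩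
    refine ⟨z, fun F _ => mem_cechLocDegree_iff.2 fun a h => hz F.1 a ?_, rfl⟩
    rw [cochainCoef_of _ F.2]
    exact h

/-- The toggling argument is applied in each multidegree separately, and the corrections are
assembled into one cochain. -/
theorem exists_cochain_sub_critical (hT : ∀ a, IsToggle (fun F => IsFaceExp G F a) (Z a) (u a))
    {p : ℕ} {ℓ : ℤ} {z : EdgeCochain k G (p + 1)}
    (hz : cechD (polyVars k) (EdgeRing k G) (p + 1) z = 0)
    (hℓ : ∀ F a, cochainCoef z F a ≠ 0 → ∑ v, a v = ℓ) :
    ∃ β : EdgeCochain k G p, ∀ F a,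
      cochainCoef (z - cechD (polyVars k) (EdgeRing k G) p β : EdgeCochain k G (p + 1)) F a ≠ 0 →
        (F, a) ∈ criticalCells G Z u (p + 1) ℓ := by
  classical
  -- The last clause, no correction where `z` vanishes, keeps the set of multidegrees finite and the
  -- degree equal to `ℓ`.
  have hb : ∀ a, ∃ b : Finset (Fin (Fintype.card σ)) → k,
      (∀ F, b F ≠ 0 → IsFaceExp G F a ∧ F.card = p) ∧
      (∀ F, u a (F ∩ Z a) ≠ none →
        cochainCoef z F a - relCobd (fun E => IsFaceExp G E a) b F = 0) ∧
      ((∀ F, cochainCoef z F a = 0) → b = 0) := by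
    intro a
    by_cases h0 : ∀ F, cochainCoef z F a = 0
    · exact ⟨0, by simp, by simp [h0, relCobd, finsetCobd], fun _ => rfl⟩
    · obtain ⟨b, h1, h2⟩ := (hT a).exists_sub_relCobd (f := fun F => cochainCoef z F a)
        (fun F hF => cochainCoef_ne_zero hF) (fun F _ => by
          rw [← cochainCoef_cechD, hz, map_zero]; rfl)
      exact ⟨b, fun F hF => ⟨(h1 F hF).1, by have := (h1 F hF).2; omega⟩, h2,
        fun h => absurd h h0⟩
  choose b hb1 hb2 hb3 using hb
  obtain ⟨β, hβ⟩ := exists_cochainCoef_eq (k := k) (G := G) (p := p) (fun F a => b a F)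
    (fun F a h => hb1 a F h) ((finite_cochainCoef_ne_zero z).subset (by
      rintro a ⟨F, hF⟩
      by_contra hne
      simp only [Set.mem_ofPred_eq, not_exists, not_not] at hne
      exact hF (by rw [hb3 a hne]; rfl)))
  refine ⟨β, fun F a h => ?_⟩
  obtain ⟨h1, h2⟩ := cochainCoef_ne_zero h
  have h3 : cochainCoef (z - cechD (polyVars k) (EdgeRing k G) p β : EdgeCochain k G (p + 1)) F a =
      cochainCoef z F a - relCobd (fun E => IsFaceExp G E a) (b a) F := by
    rw [map_sub, Pi.sub_apply, Pi.sub_apply, cochainCoef_cechD, hβ]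
  rw [h3] at h
  refine ⟨h2, h1, ?_, ?_⟩
  · by_contra hu
    exact h (hb2 a F hu)
  · by_contra hne
    have h0 : ∀ E, cochainCoef z E a = 0 := by
      intro E
      by_contra hE
      exact hne (hℓ E a hE)
    refine h ?_
    rw [h0 F, hb3 a h0]
    simp [relCobd, finsetCobd]

theorem edgeLocalCohomologyDegree_eq_span
    (hT : ∀ a, IsToggle (fun F => IsFaceExp G F a) (Z a) (u a)) (p : ℕ) (ℓ : ℤ)
    [Fintype (criticalCells G Z u (p + 1) ℓ)] :
    edgeLocalCohomologyDegree k G (p + 1) ℓ =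
      Submodule.span k (Set.range (criticalClass k hT (p + 1) ℓ)) := by
  classical
  apply le_antisymm
  · intro y hy
    obtain ⟨z, hz, rfl⟩ := mem_edgeLocalCohomologyDegree_iff.1 hy
    obtain ⟨β, hβ⟩ := exists_cochain_sub_critical hT (LinearMap.mem_ker.1 z.2) hz
    have h1 := sum_criticalCochain hβ
    have h2 : (Submodule.Quotient.mk z : EdgeLocalCohomology k G (p + 1)) =
        ∑ b : criticalCells G Z u (p + 1) ℓ, cochainCoef ((z : EdgeCochain k G (p + 1)) -
          cechD (polyVars k) (EdgeRing k G) p β : EdgeCochain k G (p + 1)) b.1.1 b.1.2 •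
            criticalClass k hT (p + 1) ℓ b := by
      rw [sum_smul_criticalClass, Submodule.Quotient.eq]
      refine ⟨β, ?_⟩
      rw [map_sub, Submodule.subtype_apply, Submodule.subtype_apply, coe_sum_smul_ker]
      refine Eq.trans ?_ (congrArg (fun y => (z : EdgeCochain k G (p + 1)) - y) h1.symm)
      rw [sub_sub_cancel]
    rw [h2]
    exact Submodule.sum_mem _ fun b _ => Submodule.smul_mem _ _ (Submodule.subset_span ⟨b, rfl⟩)
  · rw [Submodule.span_le]
    rintro _ ⟨b, rfl⟩
    refine mem_edgeLocalCohomologyDegree_iff.2 ⟨_, fun F a h => ?_, rfl⟩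
    rw [cochainCoef_criticalCochain] at h
    have hb : b.1 = (F, a) := by
      by_contra hne; exact h (if_neg hne)
    have h1 := b.2
    rw [hb] at h1
    exact h1.2.2.2

/-- The dimension of a graded piece of local cohomology is the number of critical cells. -/
theorem finrank_edgeLocalCohomologyDegree
    (hT : ∀ a, IsToggle (fun F => IsFaceExp G F a) (Z a) (u a)) (p : ℕ) (ℓ : ℤ)
    (hfin : (criticalCells G Z u (p + 1) ℓ).Finite) :
    FiniteDimensional k (edgeLocalCohomologyDegree k G (p + 1) ℓ) ∧
      Module.finrank k (edgeLocalCohomologyDegree k G (p + 1) ℓ) =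
        (criticalCells G Z u (p + 1) ℓ).ncard := by
  have : Fintype (criticalCells G Z u (p + 1) ℓ) := hfin.fintype
  rw [edgeLocalCohomologyDegree_eq_span hT]
  refine ⟨FiniteDimensional.span_of_finite k (Set.finite_range _), ?_⟩
  rw [finrank_span_eq_card (linearIndependent_criticalClass hT p ℓ), ← Nat.card_eq_fintype_card]
  rfl

end Critical

/-! ### Toggling in multi-clique-whiskered graphs -/

section Whiskered

variable {V : Type*} [Fintype V] {G : SimpleGraph V} {r : ℕ} (π : CliquePartition G r)
  (n : Fin r → ℕ)

/-- The positions of the vertices of `G` in the enumeration of the vertices of the whiskered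
graph. -/
def basePositions {V : Type*} [Fintype V] {r : ℕ} (n : Fin r → ℕ) :
    Finset (Fin (Fintype.card (MultiWhiskerVertex V n))) :=
  Finset.univ.filter fun t => ((Fintype.equivFin (MultiWhiskerVertex V n)).symm t).isLeft

open Classical in
/-- The elements of a face that determine the toggle, in multidegree `a`. -/
def toggleZone (a : MultiWhiskerVertex V n → ℤ) :
    Finset (Fin (Fintype.card (MultiWhiskerVertex V n))) :=
  if ∃ v, 0 < a v then ∅ else basePositions n

/-- The vertices which may be toggled in a face with toggle zone part `H`: the positive coordinates
of `a`, or, if there are none, the whiskers outside the support whose clique avoids `H`. -/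
def CanToggle (a : MultiWhiskerVertex V n → ℤ)
    (H : Finset (Fin (Fintype.card (MultiWhiskerVertex V n))))
    (t : Fin (Fintype.card (MultiWhiskerVertex V n))) : Prop :=
  0 < a ((Fintype.equivFin _).symm t) ∨ ((∀ v, a v ≤ 0) ∧ ∃ w : Σ i : Fin r, Fin (n i),
    t = Fintype.equivFin (MultiWhiskerVertex V n) (.inr w) ∧ a (.inr w) = 0 ∧
      ∀ x ∈ π.part w.1, Fintype.equivFin (MultiWhiskerVertex V n) (.inl x) ∉ H)

open Classical in
/-- The chosen toggle. -/
def toggleVertex (a : MultiWhiskerVertex V n → ℤ)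
    (H : Finset (Fin (Fintype.card (MultiWhiskerVertex V n)))) :
    Option (Fin (Fintype.card (MultiWhiskerVertex V n))) :=
  if h : ∃ t, CanToggle π n a H t then some h.choose else none

variable {π n}

theorem canToggle_of_toggleVertex {a : MultiWhiskerVertex V n → ℤ}
    {H : Finset (Fin (Fintype.card (MultiWhiskerVertex V n)))}
    {t : Fin (Fintype.card (MultiWhiskerVertex V n))} (h : toggleVertex π n a H = some t) :
    CanToggle π n a H t := by
  unfold toggleVertex at h
  split_ifs at h with h'
  rw [← Option.some.inj h]
  exact h'.choose_spec

theorem toggleVertex_eq_none_iff {a : MultiWhiskerVertex V n → ℤ}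
    {H : Finset (Fin (Fintype.card (MultiWhiskerVertex V n)))} :
    toggleVertex π n a H = none ↔ ∀ t, ¬CanToggle π n a H t := by
  unfold toggleVertex
  split_ifs with h
  · simpa using h
  · simpa using h

theorem toggleZone_of_nonpos {a : MultiWhiskerVertex V n → ℤ} (ha : ∀ v, a v ≤ 0) :
    toggleZone n a = basePositions n :=
  if_neg fun ⟨v, hv⟩ => absurd (ha v) (not_le.2 hv)

theorem toggleZone_of_pos {a : MultiWhiskerVertex V n → ℤ} {v : MultiWhiskerVertex V n}
    (ha : 0 < a v) : toggleZone n a = ∅ := if_pos ⟨v, ha⟩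

theorem equivFin_inl_mem_basePositions (x : V) :
    Fintype.equivFin (MultiWhiskerVertex V n) (.inl x) ∈ basePositions n := by
  simp [basePositions]

theorem equivFin_inl_mem_inter {a : MultiWhiskerVertex V n → ℤ} (ha : ∀ v, a v ≤ 0)
    {F : Finset (Fin (Fintype.card (MultiWhiskerVertex V n)))} {x : V} :
    Fintype.equivFin (MultiWhiskerVertex V n) (.inl x) ∈ F ∩ toggleZone n a ↔
      Fintype.equivFin (MultiWhiskerVertex V n) (.inl x) ∈ F := by
  rw [toggleZone_of_nonpos ha, Finset.mem_inter]
  exact and_iff_left (equivFin_inl_mem_basePositions x)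

theorem adj_inr_iff {V : Type*} {G : SimpleGraph V} {π : CliquePartition G r} {w : Σ i : Fin r, Fin (n i)} {v : MultiWhiskerVertex V n} :
    (multiCliqueWhiskered G π n).Adj (.inr w) v ↔ ∃ x ∈ π.part w.1, v = .inl x := by
  rcases v with x | w'
  · simp [multiCliqueWhiskered]
  · simp [multiCliqueWhiskered]

/-- A vertex with `a_v > 0` already lies in the support and is not forced into `F`, so it moves
freely. If `a ≤ 0`, the support lies in `F`, and a whisker with `a_w = 0` moves freely when its
neighbours, the vertices of its clique, avoid `F`. That condition sees only base vertices, so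
toggling whiskers does not alter it. -/
theorem isToggle_toggleVertex (hn : ∀ i, 0 < n i) (a : MultiWhiskerVertex V n → ℤ) :
    IsToggle (fun F => IsFaceExp (multiCliqueWhiskered G π n) F a) (toggleZone n a)
      (toggleVertex π n a) where
  convex := isFaceExp_convex a
  notMem F t ht := by
    rcases canToggle_of_toggleVertex ht with h | ⟨ha, w, rfl, _⟩
    · rw [toggleZone_of_pos h]; simp
    · rw [toggleZone_of_nonpos ha]; simp [basePositions]
  insert_mem F t hF ht := by
    refine ⟨fun v hv => Finset.mem_insert_of_mem (hF.1 v hv), ?_⟩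
    rcases canToggle_of_toggleVertex ht with h | ⟨ha, w, rfl, haw, hx⟩
    · have aux : ∀ v, (a v ≠ 0 ∨ Fintype.equivFin _ v ∈ insert t F) →
          (a v ≠ 0 ∨ Fintype.equivFin _ v ∈ F) := by
        rintro v (hv | hv)
        · exact Or.inl hv
        · rcases Finset.mem_insert.1 hv with rfl | hv
          · rw [Equiv.symm_apply_apply] at h
            exact Or.inl h.ne'
          · exact Or.inr hv
      exact fun v v' hvv' h' => hF.2 v v' hvv' ⟨aux v h'.1, aux v' h'.2⟩
    · have aux : ∀ v, (a v ≠ 0 ∨ Fintype.equivFin _ v ∈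
          insert (Fintype.equivFin (MultiWhiskerVertex V n) (.inr w)) F) →
          v = .inr w ∨ Fintype.equivFin _ v ∈ F := by
        rintro v (hv | hv)
        · exact Or.inr (hF.1 v (lt_of_le_of_ne (ha v) hv))
        · rcases Finset.mem_insert.1 hv with hv | hv
          · exact Or.inl ((Fintype.equivFin _).injective hv)
          · exact Or.inr hv
      have aux' : ∀ v, (multiCliqueWhiskered G π n).Adj (.inr w) v → Fintype.equivFin _ v ∉ F := by
        intro v hv
        obtain ⟨x, hxw, rfl⟩ := adj_inr_iff.1 hv
        have := hx x hxw
        rwa [equivFin_inl_mem_inter ha] at this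
      rintro v v' hvv' ⟨h1, h2⟩
      rcases aux v h1 with rfl | h1
      · rcases aux v' h2 with rfl | h2
        · exact hvv'.ne rfl
        · exact aux' v' hvv' h2
      · rcases aux v' h2 with rfl | h2
        · exact aux' v hvv'.symm h1
        · exact hF.2 v v' hvv' ⟨Or.inr h1, Or.inr h2⟩
  erase_mem F t hF ht := by
    refine ⟨fun v hv => Finset.mem_erase.2 ⟨?_, hF.1 v hv⟩, fun v v' hvv' h => hF.2 v v' hvv'
      ⟨h.1.imp_right Finset.mem_of_mem_erase, h.2.imp_right Finset.mem_of_mem_erase⟩⟩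
    rintro rfl
    rcases canToggle_of_toggleVertex ht with h | ⟨ha, w, hw, haw, hx⟩
    · rw [Equiv.symm_apply_apply] at h
      exact lt_asymm h hv
    · rw [(Fintype.equivFin _).injective hw, haw] at hv
      exact lt_irrefl _ hv
  maximal F t hF ht htF hins := by
    rw [toggleVertex_eq_none_iff] at ht
    have ha : ∀ v, a v ≤ 0 := by
      intro v
      by_contra hv
      refine ht (Fintype.equivFin _ v) (Or.inl ?_)
      rw [Equiv.symm_apply_apply]
      exact not_le.1 hv
    have hw : ∀ w : Σ i : Fin r, Fin (n i), a (.inr w) = 0 →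
        ∃ x ∈ π.part w.1, Fintype.equivFin (MultiWhiskerVertex V n) (.inl x) ∈ F := by
      intro w haw
      by_contra hcon
      push Not at hcon
      exact ht _ (Or.inr ⟨ha, w, rfl, haw, fun x hx => by
        rw [equivFin_inl_mem_inter ha]; exact hcon x hx⟩)
    obtain ⟨v, rfl⟩ := (Fintype.equivFin (MultiWhiskerVertex V n)).surjective t
    rcases v with x | w
    · obtain ⟨i, hi⟩ := π.cover x
      -- Positivity of `n i` supplies a whisker on the clique of `x`. If its exponent is zero, the
      -- clique already meets `F` in a neighbour of `x`; otherwise the whisker itself lies in the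
      -- support and is adjacent to `x`.
      by_cases h0 : a (.inr ⟨i, 0, hn i⟩) = 0
      · obtain ⟨y, hy, hyF⟩ := hw _ h0
        have hne : x ≠ y := by
          rintro rfl; exact htF hyF
        exact hins.2 (.inl x) (.inl y) (π.isClique i hi hy hne)
          ⟨Or.inr (Finset.mem_insert_self _ _), Or.inr (Finset.mem_insert_of_mem hyF)⟩
      · exact hins.2 (.inr ⟨i, 0, hn i⟩) (.inl x) (adj_inr_iff.2 ⟨x, hi, rfl⟩)
          ⟨Or.inl h0, Or.inr (Finset.mem_insert_self _ _)⟩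
    · have h0 : a (.inr w) = 0 := by
        by_contra h0
        exact htF (hF.1 _ (lt_of_le_of_ne (ha _) h0))
      obtain ⟨y, hy, hyF⟩ := hw w h0
      exact hins.2 (.inr w) (.inl y) (adj_inr_iff.2 ⟨y, hy, rfl⟩)
        ⟨Or.inr (Finset.mem_insert_self _ _), Or.inr (Finset.mem_insert_of_mem hyF)⟩

theorem mem_minVertexCovers_iff {σ : Type*} [Fintype σ] {Γ : SimpleGraph σ} {C : Finset σ} :
    C ∈ minVertexCovers Γ ↔ (∀ u v, Γ.Adj u v → u ∈ C ∨ v ∈ C) ∧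
      ∀ D : Finset σ, (∀ u v, Γ.Adj u v → u ∈ D ∨ v ∈ D) → D ⊆ C → C ⊆ D := by
  have h : ∀ D : Finset σ, Γ.IsVertexCover (D : Set σ) ↔ ∀ u v, Γ.Adj u v → u ∈ D ∨ v ∈ D :=
    fun D => ⟨fun h u v huv => h huv, fun h u v huv => h u v huv⟩
  classical
  rw [minVertexCovers, Finset.mem_filter]
  simp only [Finset.mem_univ, true_and, Minimal, h]

open Classical in
/-- The critical cells of the whiskered graph: the complements of minimal vertex covers, with the
nonpositive exponents supported on them that do not vanish at their whiskers. -/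
theorem map_compl_mem_criticalCells_iff (hn : ∀ i, 0 < n i) (p : ℕ) (ℓ : ℤ)
    (C : Finset (MultiWhiskerVertex V n)) (a : MultiWhiskerVertex V n → ℤ) :
    (Cᶜ.map (Fintype.equivFin (MultiWhiskerVertex V n)).toEmbedding, a) ∈
        criticalCells (multiCliqueWhiskered G π n) (toggleZone n) (toggleVertex π n) p ℓ ↔
      C ∈ minVertexCovers (multiCliqueWhiskered G π n) ∧ Cᶜ.card = p ∧ (∀ v, a v ≤ 0) ∧
        (∀ v ∈ C, a v = 0) ∧ (∀ w, .inr w ∉ C → a (.inr w) ≠ 0) ∧ ∑ v, a v = ℓ := by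
  set F := Cᶜ.map (Fintype.equivFin (MultiWhiskerVertex V n)).toEmbedding with hFdef
  have hF : ∀ v, Fintype.equivFin (MultiWhiskerVertex V n) v ∈ F ↔ v ∉ C := by
    intro v; simp [hFdef]
  have hcard : F.card = Cᶜ.card := Finset.card_map _
  rw [mem_minVertexCovers_iff]
  constructor
  · rintro ⟨h1, h2, h3, h4⟩
    have hmax := (isToggle_toggleVertex (π := π) hn a).maximal F
    have h3' := toggleVertex_eq_none_iff.1 h3
    have ha : ∀ v, a v ≤ 0 := by
      intro v
      by_contra hv
      refine h3' (Fintype.equivFin _ v) (Or.inl ?_)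
      rw [Equiv.symm_apply_apply]
      exact not_le.1 hv
    have hsupp : ∀ v, a v ≠ 0 → v ∉ C := fun v hv =>
      (hF v).1 (h2.1 v (lt_of_le_of_ne (ha v) hv))
    refine ⟨⟨fun u v huv => ?_, fun D hD hDC => ?_⟩, hcard ▸ h1, ha, fun v hv => ?_, fun w hw hw0 => ?_, h4⟩
    · by_contra hcon
      push Not at hcon
      exact h2.2 u v huv ⟨Or.inr ((hF u).2 hcon.1), Or.inr ((hF v).2 hcon.2)⟩
    · intro x hxC
      by_contra hxD
      -- If a smaller cover `D` omits `x`, then adding `x` to `F` stays inside the independent set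
      -- `Dᶜ`, against maximality.
      refine hmax (Fintype.equivFin _ x) h2 h3 (by rw [hF]; exact not_not.2 hxC)
        ⟨fun v hv => Finset.mem_insert_of_mem (h2.1 v hv), fun u v huv h => ?_⟩
      have aux : ∀ v, (a v ≠ 0 ∨ Fintype.equivFin _ v ∈ insert (Fintype.equivFin _ x) F) →
          v ∉ D := by
        rintro v (hv | hv) hvD
        · exact hsupp v hv (hDC hvD)
        · rcases Finset.mem_insert.1 hv with hv | hv
          · rw [(Fintype.equivFin _).injective hv] at hvD
            exact hxD hvD
          · exact (hF v).1 hv (hDC hvD)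
      exact (hD u v huv).elim (aux u h.1) (aux v h.2)
    · by_contra hne
      exact hsupp v hne hv
    · refine h3' _ (Or.inr ⟨ha, w, rfl, hw0, fun x hx => ?_⟩)
      rw [equivFin_inl_mem_inter ha]
      intro hxF
      exact h2.2 (.inr w) (.inl x) (adj_inr_iff.2 ⟨x, hx, rfl⟩)
        ⟨Or.inr ((hF _).2 hw), Or.inr hxF⟩
  · rintro ⟨⟨hcov, hmin⟩, h1, ha, hC, hw, h4⟩
    have hsupp : ∀ v, a v ≠ 0 → v ∉ C := fun v hv hvC => hv (hC v hvC)
    have aux : ∀ v, (a v ≠ 0 ∨ Fintype.equivFin _ v ∈ F) → v ∉ C := by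
      rintro v (hv | hv)
      · exact hsupp v hv
      · exact (hF v).1 hv
    refine ⟨hcard.trans h1, ⟨fun v hv => (hF v).2 (hsupp v hv.ne), fun u v huv h =>
      (hcov u v huv).elim (aux u h.1) (aux v h.2)⟩, ?_, h4⟩
    rw [toggleVertex_eq_none_iff]
    rintro t (ht | ⟨-, w, rfl, haw, hx⟩)
    · exact absurd (ha _) (not_le.2 ht)
    · have hwC : .inr w ∈ C := by
        by_contra hwC
        exact hw w hwC haw
      have hxC : ∀ x ∈ π.part w.1, .inl x ∈ C := by
        intro x hxw
        have := hx x hxw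
        rw [equivFin_inl_mem_inter ha, hF] at this
        exact not_not.1 this
      have hadj : ∀ v, (multiCliqueWhiskered G π n).Adj (.inr w) v → v ∈ C.erase (.inr w) := by
        intro v hv
        obtain ⟨x, hxw, rfl⟩ := adj_inr_iff.1 hv
        exact Finset.mem_erase.2 ⟨by simp, hxC x hxw⟩
      -- A toggleable whisker would lie in `C` together with all its neighbours, so it could be
      -- dropped from the cover.
      have := hmin (C.erase (.inr w)) (fun u v huv => ?_) (Finset.erase_subset _ _) hwC
      · simp at this
      · by_cases hu : u = .inr w
        · subst hu
          exact Or.inr (hadj v huv)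
        · by_cases hv : v = .inr w
          · subst hv
            exact Or.inl (hadj u huv.symm)
          · exact (hcov u v huv).imp (fun h => Finset.mem_erase.2 ⟨hu, h⟩)
              (fun h => Finset.mem_erase.2 ⟨hv, h⟩)

end Whiskered

/-! ### The Hilbert series -/

section HilbertSeries

open Classical in
/-- The generating series of the exponents of one vertex: positive at a whisker, nonnegative at a
vertex of the base graph. -/
def vertexSeries {V W : Type*} (v : V ⊕ W) : PowerSeries ℚ :=
  PowerSeries.mk fun m => if v.isLeft ∨ m ≠ 0 then 1 else 0

theorem vertexSeries_inl {V W : Type*} (x : V) :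
    vertexSeries (.inl x : V ⊕ W) = PowerSeries.mk 1 := by
  ext m; simp [vertexSeries]

theorem vertexSeries_inr {V W : Type*} (w : W) :
    vertexSeries (.inr w : V ⊕ W) = PowerSeries.X * PowerSeries.mk 1 := by
  ext m
  rcases m with _ | m
  · simp [vertexSeries]
  · simp [vertexSeries, PowerSeries.coeff_succ_X_mul]

open Classical in
theorem coeff_prod_vertexSeries {V W : Type*} (M : Finset (V ⊕ W)) (d : ℕ) :
    PowerSeries.coeff d (∏ v ∈ M, vertexSeries v) =
      (((Finset.finsuppAntidiag M d).filter fun l => ∀ v ∈ M, v.isLeft ∨ l v ≠ 0).card : ℚ) := by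
  rw [PowerSeries.coeff_prod]
  simp only [vertexSeries, PowerSeries.coeff_mk, Finset.prod_boole]
  rw [Finset.sum_boole]

theorem coe_mk_one_eq : ((PowerSeries.mk 1 : PowerSeries ℚ) : LaurentSeries ℚ) = (1 - tInv)⁻¹ := by
  refine eq_inv_of_mul_eq_one_left ?_
  have h := congrArg (fun f : PowerSeries ℚ => (f : LaurentSeries ℚ))
    (PowerSeries.mk_one_mul_one_sub_eq_one ℚ)
  simpa [tInv] using h

theorem one_sub_tInv_ne_zero : (1 - tInv : LaurentSeries ℚ) ≠ 0 := by
  intro h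
  have h1 := congrArg (fun f : LaurentSeries ℚ => f.coeff 0) h
  simp [tInv] at h1

theorem coe_prod_vertexSeries {V W : Type*} (M : Finset (V ⊕ W)) :
    ((∏ v ∈ M, vertexSeries v : PowerSeries ℚ) : LaurentSeries ℚ) =
      ((1 - tInv)⁻¹) ^ (M.filter fun v => v.isLeft).card *
        (tInv / (1 - tInv)) ^ (M.filter fun v => ¬v.isLeft).card := by
  have h : ∀ v : V ⊕ W, ((vertexSeries v : PowerSeries ℚ) : LaurentSeries ℚ) =
      if v.isLeft then (1 - tInv)⁻¹ else tInv / (1 - tInv) := by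
    rintro (x | w)
    · rw [vertexSeries_inl, coe_mk_one_eq]; simp
    · rw [vertexSeries_inr, PowerSeries.coe_mul, coe_mk_one_eq, PowerSeries.coe_X]
      simp [tInv, div_eq_mul_inv]
  rw [map_prod, Finset.prod_congr rfl fun v _ => h v, Finset.prod_ite, Finset.prod_const,
    Finset.prod_const]

/-- The binomial theorem for `(1 + u) ^ b`. Terms with `i > b` vanish, so `m` is only a uniform
cutoff, and `b ≤ j` keeps the surviving exponents nonnegative. -/
theorem sum_choose_mul_zpow {K : Type*} [Field K] (u : K) {b j m : ℕ} (hbj : b ≤ j) (hbm : b ≤ m) :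
    ∑ i ∈ Finset.range (m + 1), ((b.choose i : ℕ) : K) * u ^ ((j : ℤ) - (i : ℤ)) =
      (1 + u) ^ b * u ^ (j - b) := by
  rw [add_pow, Finset.sum_mul]
  rw [← Finset.sum_subset (Finset.range_subset_range.2 (Nat.succ_le_succ hbm)) fun i _ hi => by
    rw [Nat.choose_eq_zero_of_lt (by simpa using hi)]; simp]
  refine Finset.sum_congr rfl fun i hi => ?_
  have hi : i ≤ b := by simpa [Nat.lt_succ_iff] using hi
  have h1 : ((j : ℤ) - (i : ℤ)) = ((b - i + (j - b) : ℕ) : ℤ) := by omega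
  rw [h1, zpow_natCast, pow_add, one_pow]
  ring

end HilbertSeries

/-! ### Counting the critical cells of the whiskered graph -/

section Count

variable {V : Type*} [Fintype V] {G : SimpleGraph V} {r : ℕ} {π : CliquePartition G r}
  {n : Fin r → ℕ}

theorem card_baseCompl (C : Finset (MultiWhiskerVertex V n)) [DecidableEq (MultiWhiskerVertex V n)] :
    (baseCompl C).card = (Cᶜ.filter fun v => v.isLeft).card := by
  rw [← Finset.card_map ⟨Sum.inl, Sum.inl_injective⟩]
  congr 1
  ext v
  rcases v with x | w <;> simp [baseCompl]

open Classical in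
variable (π n) in
/-- Pairs of a minimal vertex cover of size `N - p` and the exponents on its complement. -/
def coverExps (p d : ℕ) : Finset (Σ _ : Finset (MultiWhiskerVertex V n), MultiWhiskerVertex V n →₀ ℕ) :=
  ((minVertexCovers (multiCliqueWhiskered G π n)).filter
    (fun C => (C.card : ℤ) = Fintype.card (MultiWhiskerVertex V n) - p)).sigma fun C =>
      (Finset.finsuppAntidiag Cᶜ d).filter fun l => ∀ v ∈ Cᶜ, v.isLeft ∨ l v ≠ 0

/-- The critical cell of a minimal vertex cover and an exponent on its complement. -/
def coverExpCell (x : Σ _ : Finset (MultiWhiskerVertex V n), MultiWhiskerVertex V n →₀ ℕ) :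
    Finset (Fin (Fintype.card (MultiWhiskerVertex V n))) × (MultiWhiskerVertex V n → ℤ) :=
  open Classical in
  (x.1ᶜ.map (Fintype.equivFin (MultiWhiskerVertex V n)).toEmbedding, fun v => -(x.2 v : ℤ))

theorem coverExpCell_injective :
    Function.Injective (coverExpCell : (Σ _ : Finset (MultiWhiskerVertex V n),
      MultiWhiskerVertex V n →₀ ℕ) → _) := by
  classical
  rintro ⟨C, l⟩ ⟨C', l'⟩ h
  simp only [coverExpCell, Prod.mk.injEq, Finset.map_inj, compl_inj_iff] at h
  obtain ⟨rfl, h⟩ := h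
  have : l = l' := by
    ext v
    simpa using congrFun h v
  rw [this]

theorem card_compl_eq_iff {σ : Type*} [Fintype σ] [DecidableEq σ] (C : Finset σ) (p : ℕ) :
    (C.card : ℤ) = Fintype.card σ - p ↔ Cᶜ.card = p := by
  have := Finset.card_add_card_compl C
  omega

/-- Negating exponents turns the classification of critical cells into a finite enumeration by
covers and antidiagonals, which also gives finiteness. -/
theorem coe_image_coverExps (hn : ∀ i, 0 < n i) (p d : ℕ) :
    coverExpCell '' (coverExps π n p d : Set _) =
      criticalCells (multiCliqueWhiskered G π n) (toggleZone n) (toggleVertex π n) p (-(d : ℤ)) := by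
  classical
  ext ⟨F, a⟩
  have hFC : ∀ F : Finset (Fin (Fintype.card (MultiWhiskerVertex V n))),
      ∃ C : Finset (MultiWhiskerVertex V n),
        F = Cᶜ.map (Fintype.equivFin (MultiWhiskerVertex V n)).toEmbedding := by
    intro F
    refine ⟨(F.map (Fintype.equivFin (MultiWhiskerVertex V n)).symm.toEmbedding)ᶜ, ?_⟩
    rw [compl_compl]
    ext t
    simp
  constructor
  · rintro ⟨⟨C, l⟩, hx, hxF⟩
    rw [← hxF]
    simp only [coverExps, Finset.mem_coe, Finset.mem_sigma, Finset.mem_filter,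
      Finset.mem_finsuppAntidiag, card_compl_eq_iff] at hx
    obtain ⟨⟨hC, hp⟩, ⟨hsum, hsupp⟩, hl⟩ := hx
    have hlC : ∀ v ∈ C, l v = 0 := by
      intro v hv
      by_contra hne
      have := hsupp (Finsupp.mem_support_iff.2 hne)
      exact Finset.mem_compl.1 this hv
    refine (map_compl_mem_criticalCells_iff hn p _ C _).2 ⟨hC, hp, fun v => by simp,
      fun v hv => by simp [hlC v hv], fun w hw => ?_, ?_⟩
    · have := hl _ (Finset.mem_compl.2 hw)
      simpa using this
    · rw [Finset.sum_neg_distrib, ← hsum, Nat.cast_sum]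
      congr 1
      refine (Finset.sum_subset (Finset.subset_univ _) fun v _ hv => ?_).symm
      rw [hlC v (by simpa using hv)]; rfl
  · intro h
    obtain ⟨C, rfl⟩ := hFC F
    obtain ⟨hC, hp, ha, haC, hw, hsum⟩ := (map_compl_mem_criticalCells_iff hn p _ C a).1 h
    refine ⟨⟨C, Finsupp.equivFunOnFinite.symm fun v => (a v).natAbs⟩, ?_, ?_⟩
    · simp only [coverExps, Finset.mem_coe, Finset.mem_sigma, Finset.mem_filter,
        Finset.mem_finsuppAntidiag, card_compl_eq_iff]
      refine ⟨⟨hC, hp⟩, ⟨?_, fun v hv => ?_⟩, ?_⟩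
      · zify
        simp only [Finsupp.equivFunOnFinite_symm_apply_apply]
        rw [← neg_inj, ← hsum, ← Finset.sum_neg_distrib]
        rw [Finset.sum_subset (Finset.subset_univ _) fun v _ hv => by
          rw [haC v (by simpa using hv)]; simp]
        refine Finset.sum_congr rfl fun v _ => ?_
        have := ha v
        rw [Int.natCast_natAbs, abs_of_nonpos this, neg_neg]
      · rw [Finset.mem_compl]
        intro hvC
        rw [Finsupp.mem_support_iff] at hv
        exact hv (by simp [haC v hvC])
      · rintro (x | w) hv
        · exact Or.inl rfl
        · exact Or.inr (by simpa using hw w (Finset.mem_compl.1 hv))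
    · simp only [coverExpCell, Prod.mk.injEq, true_and]
      funext v
      have := ha v
      simp only [Finsupp.equivFunOnFinite_symm_apply_apply]
      rw [Int.natCast_natAbs, abs_of_nonpos this, neg_neg]

/-- Positive total degree needs a positive coordinate, and that coordinate could be toggled. -/
theorem criticalCells_eq_empty (p : ℕ) {ℓ : ℤ} (hℓ : 0 < ℓ) :
    criticalCells (multiCliqueWhiskered G π n) (toggleZone n) (toggleVertex π n) p ℓ = ∅ := by
  rw [Set.eq_empty_iff_forall_notMem]
  rintro ⟨F, a⟩ ⟨-, -, h3, h4⟩
  have ha : ∀ v, a v ≤ 0 := by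
    intro v
    by_contra hv
    refine toggleVertex_eq_none_iff.1 h3 (Fintype.equivFin _ v) (Or.inl ?_)
    rw [Equiv.symm_apply_apply]
    exact not_le.1 hv
  exact absurd (Finset.sum_nonpos fun v _ => ha v) (not_le.2 (hℓ.trans_eq h4.symm))

open Classical in
variable (π n) in
/-- The Hilbert series of local cohomology, as a power series in `t⁻¹`. -/
def coverSeries (p : ℕ) : PowerSeries ℚ :=
  ∑ C ∈ (minVertexCovers (multiCliqueWhiskered G π n)).filter
    (fun C => (C.card : ℤ) = Fintype.card (MultiWhiskerVertex V n) - p),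
      ∏ v ∈ Cᶜ, vertexSeries v

theorem coeff_coverSeries (p d : ℕ) :
    PowerSeries.coeff d (coverSeries π n p) = ((coverExps π n p d).card : ℚ) := by
  classical
  rw [coverSeries, map_sum, coverExps, Finset.card_sigma, Nat.cast_sum]
  refine Finset.sum_congr rfl fun C _ => ?_
  rw [coeff_prod_vertexSeries]
  congr!

theorem coe_coverSeries (p : ℕ) : ((coverSeries π n p : PowerSeries ℚ) : LaurentSeries ℚ) =
    ∑ i ∈ Finset.range (Fintype.card V + 1),
      ∑ C ∈ (minVertexCovers (multiCliqueWhiskered G π n)).filter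
          (fun C => (C.card : ℤ) = Fintype.card (MultiWhiskerVertex V n) - p),
        (((baseCompl C).card.choose i : ℕ) : LaurentSeries ℚ) *
          (tInv / (1 - tInv)) ^ ((p : ℤ) - (i : ℤ)) := by
  classical
  rw [Finset.sum_comm, coverSeries, map_sum]
  refine Finset.sum_congr rfl fun C hC => ?_
  have hp : Cᶜ.card = p := by
    rw [← card_compl_eq_iff]
    exact (Finset.mem_filter.1 hC).2
  have h1 := Finset.card_filter_add_card_filter_not (s := Cᶜ)
    (fun v : MultiWhiskerVertex V n => (v.isLeft : Prop))
  rw [← card_baseCompl, hp] at h1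
  have h2 : 1 + tInv / (1 - tInv) = (1 - tInv)⁻¹ := by
    rw [inv_eq_one_div, eq_div_iff one_sub_tInv_ne_zero, add_mul,
      div_mul_cancel₀ _ one_sub_tInv_ne_zero]
    ring
  -- The base part of `Cᶜ` has at most `p` elements and at most `Fintype.card V`, as the binomial
  -- identity requires.
  rw [coe_prod_vertexSeries, ← card_baseCompl, sum_choose_mul_zpow _ (by omega)
    (Finset.card_le_univ _), h2]
  congr 2
  exact Nat.eq_sub_of_add_eq' (by convert h1)

theorem ncard_criticalCells (hn : ∀ i, 0 < n i) (p : ℕ) (ℓ : ℤ) :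
    (criticalCells (multiCliqueWhiskered G π n) (toggleZone n) (toggleVertex π n) p ℓ).Finite ∧
      ((criticalCells (multiCliqueWhiskered G π n) (toggleZone n) (toggleVertex π n) p ℓ).ncard : ℚ) =
        if -ℓ < 0 then 0 else PowerSeries.coeff (-ℓ).natAbs (coverSeries π n p) := by
  rcases lt_or_ge 0 ℓ with hℓ | hℓ
  · rw [if_pos (by omega), criticalCells_eq_empty p hℓ]
    exact ⟨Set.finite_empty, by simp⟩
  · obtain ⟨d, rfl⟩ : ∃ d : ℕ, ℓ = -(d : ℤ) := ⟨ℓ.natAbs, by omega⟩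
    rw [← coe_image_coverExps hn, Set.ncard_image_of_injective _ coverExpCell_injective,
      Set.ncard_coe_finset, if_neg (by omega), neg_neg, Int.natAbs_natCast, coeff_coverSeries]
    exact ⟨(Finset.finite_toSet _).image _, rfl⟩

theorem finrank_edgeLocalCohomologyDegree_multiCliqueWhiskered {k : Type*} [Field k] (hn : ∀ i, 0 < n i) (p : ℕ) (ℓ : ℤ) :
    FiniteDimensional k (edgeLocalCohomologyDegree k (multiCliqueWhiskered G π n) (p + 1) ℓ) ∧
      (Module.finrank k (edgeLocalCohomologyDegree k (multiCliqueWhiskered G π n) (p + 1) ℓ) : ℚ) =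
        if -ℓ < 0 then 0 else PowerSeries.coeff (-ℓ).natAbs (coverSeries π n (p + 1)) := by
  obtain ⟨hfin, hcard⟩ := ncard_criticalCells (π := π) hn (p + 1) ℓ
  obtain ⟨h1, h2⟩ := finrank_edgeLocalCohomologyDegree (k := k)
    (isToggle_toggleVertex (π := π) hn) p ℓ hfin
  exact ⟨h1, by rw [h2, hcard]⟩

end Count

theorem mainTheorem10 {k : Type*} [Field k] {V : Type*} [Fintype V] (G : SimpleGraph V)
    {r : ℕ} (π : CliquePartition G r) (n : Fin r → ℕ) (hn : ∀ i, 0 < n i)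
    (j : ℕ) (hj : 0 < j) :
    HasHilbertSeriesInv (edgeLocalCohomologyDegree k (multiCliqueWhiskered G π n) j)
      (∑ i ∈ Finset.range (Fintype.card V + 1),
        ∑ C ∈ (minVertexCovers (multiCliqueWhiskered G π n)).filter
            (fun C => (C.card : ℤ) = Fintype.card (MultiWhiskerVertex V n) - j),
          (((baseCompl C).card.choose i : ℕ) : LaurentSeries ℚ) *
            (tInv / (1 - tInv)) ^ ((j : ℤ) - (i : ℤ))) := by
  -- In degree `p + 1` the coboundaries are the range of a Čech differential, which is the form used
  -- by the critical-cell count.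
  obtain ⟨p, rfl⟩ : ∃ p, j = p + 1 := ⟨j - 1, by omega⟩
  intro ℓ
  obtain ⟨h1, h2⟩ :=
    finrank_edgeLocalCohomologyDegree_multiCliqueWhiskered (k := k) (G := G) (π := π) hn p ℓ
  refine ⟨h1, ?_⟩
  rw [← coe_coverSeries, PowerSeries.coeff_coe, h2]

end
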